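/- There is an absolute constant $C>0$ such that the following holds for all integers $d\ge 1$, $n\ge 0$ and $s\ge 2$. Put $$m \;=\; 2^{\,n\left(1-\frac{1}{C\,(C\log_2 s)^{d-1}}\right)} .$$ Let $f:\{0,1\}^n\to\{0,1\}$ be a monotone function that is computed by an $\mathsf{AC}^0$ circuit of depth at most $d$ and size at most $s$, that is, by a circuit with unbounded fan-in $\wedge$ and $\vee$ gates whose inputs are the literals $x_1,\overline{x_1},\dots,x_n,\overline{x_n}$. Then $f$ is computed by a monotone circuit ($\wedge$ and $\vee$ gates of fan-in at most two, whose inputs are variables and the constants $0,1$) of size at most $n\cdot m$. Moreover, $f$ is computed by a monotone DNF (a DNF without negated literals) with at most $m$ terms. Here the size of a circuit is its number of gates, and its depth is the largest number of gates on a path from an input to the output. -/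

import Mathlib

namespace MonoSim

/-- A literal over `x_0, …, x_{n-1}`: `(i, true)` is `x_i` and `(i, false)` is its negation. -/
abbrev Literal (n : ℕ) : Type := Fin n × Bool

/-- Value of a literal at an assignment. -/
def Literal.eval {n : ℕ} (x : Fin n → Bool) (l : Literal n) : Bool := x l.1 == l.2

/-- The two gate types. -/
inductive GateOp : Type
  | and
  | or

/-- A gate of unbounded fan-in applied to the bits `v w`, `w ∈ I`
(an empty AND is `true`, an empty OR is `false`). -/
def GateOp.eval {W : Type} (v : W → Bool) (I : Finset W) : GateOp → Bool
  | .and => decide (∀ w ∈ I, v w = true)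
  | .or => decide (∃ w ∈ I, v w = true)

/-- A topologically ordered list of `m` AND/OR gates whose inputs are leaves, labelled by `α`,
or earlier gates. Gates may be reused, so this is a directed acyclic graph. -/
inductive Gates (α : Type) : ℕ → Type
  | nil : Gates α 0
  | snoc {m : ℕ} (G : Gates α m) (op : GateOp) (I : Finset (α ⊕ Fin m)) : Gates α (m + 1)

namespace Gates

/-- The value of every gate, given the values of the leaves. -/
def val {α : Type} (a : α → Bool) : {m : ℕ} → Gates α m → Fin m → Bool
  | _, .nil => Fin.elim0
  | _, .snoc G op I =>
      Fin.snoc (α := fun _ => Bool) (G.val a) (op.eval (Sum.elim a (G.val a)) I)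

/-- The depth of every gate: the largest number of gates on a path from a leaf up to and
including the gate. -/
def depth {α : Type} : {m : ℕ} → Gates α m → Fin m → ℕ
  | _, .nil => Fin.elim0
  | _, .snoc G _ I =>
      Fin.snoc (α := fun _ => ℕ) G.depth (I.sup (Sum.elim (fun _ => 0) G.depth) + 1)

/-- Every gate has at most `k` inputs. -/
def FanInLE {α : Type} (k : ℕ) : {m : ℕ} → Gates α m → Prop
  | _, .nil => True
  | _, .snoc G _ I => G.FanInLE k ∧ I.card ≤ k

end Gates

/-- A circuit with unbounded fan-in AND/OR gates and leaves labelled by `α`. Its output is a gate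
or a leaf, and its size is its number of gates. -/
structure Circuit (α : Type) where
  size : ℕ
  gates : Gates α size
  output : α ⊕ Fin size

namespace Circuit

/-- Output of a circuit, given the values of the leaves. -/
def eval {α : Type} (c : Circuit α) (a : α → Bool) : Bool :=
  Sum.elim a (c.gates.val a) c.output

/-- Depth of a circuit: the largest number of gates on a path from a leaf to the output. -/
def depth {α : Type} (c : Circuit α) : ℕ :=
  Sum.elim (fun _ => 0) c.gates.depth c.output

end Circuit

/-- `AC0 n d s`: the `n`-variable Boolean functions computed by a circuit of depth at most `d` and
size at most `s`, with unbounded fan-in AND/OR gates and input literals. -/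
def AC0 (n d s : ℕ) : Set ((Fin n → Bool) → Bool) :=
  {f | ∃ c : Circuit (Literal n), c.depth ≤ d ∧ c.size ≤ s ∧
    ∀ x, c.eval (Literal.eval x) = f x}

/-- An input of a monotone circuit: a variable (`Sum.inl i`) or a constant (`Sum.inr b`). -/
abbrev MonoInput (n : ℕ) : Type := Fin n ⊕ Bool

/-- `mSIZE n t`: the `n`-variable Boolean functions computed by a monotone circuit, with AND/OR
gates of fan-in at most two and no negations, of size at most `t`. -/
def mSIZE (n : ℕ) (t : ℝ) : Set ((Fin n → Bool) → Bool) :=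
  {f | ∃ c : Circuit (MonoInput n), c.gates.FanInLE 2 ∧ (c.size : ℝ) ≤ t ∧
    ∀ x, c.eval (Sum.elim x id) = f x}

/-- A DNF: a set of terms, each a set of literals. -/
abbrev DNF (n : ℕ) : Type := Finset (Finset (Literal n))

namespace DNF

/-- Value of a DNF: some term has all its literals true. -/
def eval {n : ℕ} (D : DNF n) (x : Fin n → Bool) : Bool :=
  decide (∃ T ∈ D, ∀ l ∈ T, Literal.eval x l = true)

/-- A DNF is monotone if it has no negative literal. -/
def IsMonotone {n : ℕ} (D : DNF n) : Prop := ∀ T ∈ D, ∀ l ∈ T, l.2 = true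

end DNF

/-- `mDNF n t`: the `n`-variable Boolean functions computed by a monotone DNF with at most `t`
terms. -/
def mDNF (n : ℕ) (t : ℝ) : Set ((Fin n → Bool) → Bool) :=
  {f | ∃ D : DNF n, D.IsMonotone ∧ (D.card : ℝ) ≤ t ∧ ∀ x, D.eval x = f x}

/-- The bound `2 ^ (n (1 - 1 / (C (C log₂ s) ^ (d - 1))))`. It is used for `1 ≤ d` and `2 ≤ s`. -/
noncomputable def simBound (C : ℝ) (n d s : ℕ) : ℝ :=
  (2 : ℝ) ^ ((n : ℝ) * (1 - 1 / (C * (C * Real.logb 2 (s : ℝ)) ^ (d - 1))))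

end MonoSim

/-!
A monotone function `f` with a decision tree of `N` leaves has a monotone DNF with `N` terms and a
monotone circuit with `2 (N - 1)` gates, because `f = f₀ ∨ (xᵢ ∧ f₁)` for the two restrictions
`f₀ ≤ f₁` of `f` at a variable `xᵢ` (`HasTree.exists_monotone_dnf`, `HasTree.exists_monotone_gates`).
So it suffices that a circuit of depth `d` with `s` gates has a decision tree with few leaves
(`treeSize_circuit_mul_pow_le`): at most `2 ^ d (2 / (1 + p)) ^ n` of them, where `1 / p` is
`32 (32 ⌈log₂ s⌉) ^ (d - 1)`. The factor `2 ^ d` only matters when `n p` is less than `2 d`, and then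
already the trivial bound `(3 / 4) 2 ^ n` for monotone functions (`treeSize_le_of_monotone`) is good
enough. For `n ≤ 1` the function is a constant or a variable.

The tree is built level by level. Suppose that on a subcube all gates up to some level have decision
trees of depth `k`. Then the gates of the next level are `k`-DNFs or negations of such, and the
multi-switching lemma applies (`subsetExp_expect_le`): if each free variable remains free with
probability `1 / (32 k)` and the others are fixed at random, then a common partial decision tree
with at most `2` leaves in expectation makes all these gates have decision trees of depth `ℓ = ⌈log₂ s⌉`.
Querying the variables that are not kept, and then continuing with the common tree, gives the
recursion `treeSize_mul_pow_le`. In it the common tree is not constructed: only the facts that the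
least tree size is subadditive under splitting a subcube and bounded on the shallow subcubes matter,
so the lemma is stated for an arbitrary functional `ω` with these properties.

The multi-switching lemma is proved by exchanging the order of the random choices. A subcube is a
pair of a set `Λ` of free variables and an assignment `y` whose values on `Λ` are ignored. If a DNF is
deep on the subcube, then its canonical decision tree has a long path. When the variables queried
along the path are given the values that satisfy the terms they come from, the resulting complete
assignment determines, together with a little advice, the set `V` of these variables
(`le_expect_pathSum`). Hence one can fix the complete assignment first and choose `Λ` afterwards, and
`V ⊆ Λ` then has probability `q ^ |V|`, which outweighs the number of possible advices
(`subsetExp_pathSum_le`).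
-/

namespace MonoSim

open Finset
open scoped BigOperators

/-! ### Averages over the cube and over random subsets -/

/-- Resampling the coordinates in `S` of a uniform point of the cube leaves it uniform. -/
theorem expect_expect_piecewise {n : ℕ} (S : Finset (Fin n)) (h : (Fin n → Bool) → ℝ) :
    𝔼 b, 𝔼 z, h (S.piecewise b z) = 𝔼 z, h z := by
  have key : Function.Involutive
      (fun p : (Fin n → Bool) × (Fin n → Bool) => (S.piecewise p.1 p.2, S.piecewise p.2 p.1)) := by
    rintro ⟨b, z⟩
    ext i <;> by_cases hi : i ∈ S <;> simp [hi]
  have h1 : 𝔼 p : (Fin n → Bool) × (Fin n → Bool), h (S.piecewise p.1 p.2)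
      = 𝔼 p : (Fin n → Bool) × (Fin n → Bool), h p.1 :=
    Fintype.expect_equiv key.toPerm _ _ (fun p => rfl)
  rw [← univ_product_univ, expect_product, expect_product] at h1
  rw [h1]
  simp

/-- A uniform point is obtained by choosing the coordinate `i` last. -/
theorem expect_eq_expect_update {n : ℕ} (i : Fin n) (h : (Fin n → Bool) → ℝ) :
    2 * 𝔼 z, h z = ∑ c : Bool, 𝔼 z, h (Function.update z i c) := by
  have key : Function.Involutive (fun z : Fin n → Bool => Function.update z i (!z i)) := by
    intro z
    ext j
    by_cases hj : j = i
    · subst hj; simp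
    · simp [hj]
  have h1 : 𝔼 z, h z = 𝔼 z, h (Function.update z i (!z i)) :=
    (Fintype.expect_equiv key.toPerm _ _ (fun p => rfl)).symm
  have h2 : 2 * 𝔼 z, h z = 𝔼 z, (h z + h (Function.update z i (!z i))) := by
    rw [expect_add_distrib, ← h1, two_mul]
  rw [h2, Fintype.sum_bool, ← expect_add_distrib]
  refine expect_congr rfl fun z _ => ?_
  have hz : z = Function.update z i (z i) := by simp
  cases hc : z i <;> rw [hc] at hz <;> simp only [Bool.not_false, Bool.not_true]
  · rw [← hz, add_comm]
  · rw [← hz]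

theorem piecewise_insert_update {n : ℕ} {i : Fin n} {S : Finset (Fin n)}
    (b y : Fin n → Bool) (c : Bool) :
    (insert i S).piecewise (Function.update b i c) y = Function.update (S.piecewise b y) i c := by
  ext j
  by_cases hj : j = i
  · subst hj; simp
  · by_cases hS : j ∈ S <;> simp [hj, hS]

/-- A nonnegative function is at most `2 ^ |S|` times its average over the `2 ^ |S|` values of the
coordinates in `S`. -/
theorem le_two_pow_mul_expect {n : ℕ} (S : Finset (Fin n)) {h : (Fin n → Bool) → ℝ}
    (h0 : ∀ z, 0 ≤ h z) (b y : Fin n → Bool) :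
    h (S.piecewise b y) ≤ 2 ^ S.card * 𝔼 a, h (S.piecewise a y) := by
  induction S using Finset.induction_on generalizing h with
  | empty => simp
  | insert i S hi ih =>
    have ih' := ih (h := fun z => h (Function.update z i (b i))) (fun z => h0 _)
    rw [← piecewise_insert_update, Function.update_eq_self] at ih'
    refine ih'.trans ?_
    rw [card_insert_of_notMem hi, pow_succ, mul_assoc, expect_eq_expect_update i]
    refine mul_le_mul_of_nonneg_left ?_ (by positivity)
    simp only [piecewise_insert_update]
    exact single_le_sum (f := fun c => 𝔼 a, h (Function.update (S.piecewise a y) i c))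
      (fun c _ => expect_nonneg fun z _ => h0 _) (mem_univ (b i))

/-- A function of subcubes `(Λ, y)` that is subadditive under splitting a subcube along one free
variable is subadditive under splitting it along a set `S` of free variables. -/
theorem le_two_pow_mul_expect_of_split {n : ℕ} {U : Finset (Fin n)}
    {ω : Finset (Fin n) → (Fin n → Bool) → ℝ}
    (hω : ∀ Λ ⊆ U, ∀ y, ∀ i ∈ Λ, ω Λ y ≤ ∑ c : Bool, ω (Λ.erase i) (Function.update y i c))
    {Λ : Finset (Fin n)} (hΛ : Λ ⊆ U) (S : Finset (Fin n)) (hS : S ⊆ Λ) (y : Fin n → Bool) :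
    ω Λ y ≤ 2 ^ S.card * 𝔼 b, ω (Λ \ S) (S.piecewise b y) := by
  induction S using Finset.induction_on with
  | empty => simp
  | insert i S hi ih =>
    refine (ih ((subset_insert i S).trans hS)).trans ?_
    rw [card_insert_of_notMem hi, pow_succ, mul_assoc, expect_eq_expect_update i,
      ← expect_sum_comm]
    refine mul_le_mul_of_nonneg_left (expect_le_expect fun b _ => ?_) (by positivity)
    have h1 : i ∈ Λ \ S := mem_sdiff.2 ⟨hS (mem_insert_self i S), hi⟩
    refine (hω (Λ \ S) (sdiff_subset.trans hΛ) (S.piecewise b y) i h1).trans (le_of_eq ?_)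
    refine sum_congr rfl fun c _ => ?_
    rw [piecewise_insert_update]
    congr 1
    ext j
    simp only [mem_erase, mem_sdiff, mem_insert]
    tauto

/-- The expectation of `g Λ` for a random `Λ ⊆ U` that contains each element of `U`
independently with probability `q`. -/
noncomputable def subsetExp {n : ℕ} (q : ℝ) (U : Finset (Fin n)) (g : Finset (Fin n) → ℝ) : ℝ :=
  ∑ Λ ∈ U.powerset, q ^ Λ.card * (1 - q) ^ (U.card - Λ.card) * g Λ

section subsetExp

variable {n : ℕ} {q : ℝ}

theorem subsetExp_pow (U : Finset (Fin n)) (a : ℝ) :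
    subsetExp q U (fun Λ => a ^ Λ.card) = (q * a + (1 - q)) ^ U.card := by
  rw [subsetExp, ← Finset.sum_pow_mul_eq_add_pow]
  refine sum_congr rfl fun Λ _ => ?_
  rw [mul_pow]
  ring

theorem subsetExp_const (U : Finset (Fin n)) (a : ℝ) : subsetExp q U (fun _ => a) = a := by
  have := subsetExp_pow (q := q) U 1
  simp only [one_pow, mul_one, add_sub_cancel] at this
  rw [subsetExp] at this ⊢
  simp only [mul_one] at this
  rw [← sum_mul, this, one_mul]

theorem subsetExp_mono (hq0 : 0 ≤ q) (hq1 : q ≤ 1) {U : Finset (Fin n)}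
    {g g' : Finset (Fin n) → ℝ} (h : ∀ Λ ⊆ U, g Λ ≤ g' Λ) : subsetExp q U g ≤ subsetExp q U g' := by
  refine sum_le_sum fun Λ hΛ => mul_le_mul_of_nonneg_left (h Λ (mem_powerset.1 hΛ)) ?_
  have : 0 ≤ 1 - q := by linarith
  positivity

theorem subsetExp_add (U : Finset (Fin n)) (g g' : Finset (Fin n) → ℝ) :
    subsetExp q U (fun Λ => g Λ + g' Λ) = subsetExp q U g + subsetExp q U g' := by
  simp only [subsetExp, mul_add, sum_add_distrib]

theorem subsetExp_mul_left (U : Finset (Fin n)) (c : ℝ) (g : Finset (Fin n) → ℝ) :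
    subsetExp q U (fun Λ => c * g Λ) = c * subsetExp q U g := by
  simp only [subsetExp, mul_sum]
  exact sum_congr rfl fun _ _ => by ring

theorem subsetExp_sum {ι : Type*} (s : Finset ι) (U : Finset (Fin n))
    (g : ι → Finset (Fin n) → ℝ) :
    subsetExp q U (fun Λ => ∑ i ∈ s, g i Λ) = ∑ i ∈ s, subsetExp q U (g i) := by
  simp only [subsetExp, mul_sum]
  exact sum_comm

theorem subsetExp_expect {ι : Type*} (s : Finset ι) (U : Finset (Fin n))
    (g : ι → Finset (Fin n) → ℝ) :
    subsetExp q U (fun Λ => 𝔼 i ∈ s, g i Λ) = 𝔼 i ∈ s, subsetExp q U (g i) := by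
  simp only [subsetExp, mul_expect]
  exact (expect_sum_comm _ _ _).symm

/-- Conditioned on `S ⊆ Λ`, which has probability `q ^ |S|`, the set `Λ \ S` is again random. -/
theorem subsetExp_indicator (U S : Finset (Fin n)) (hS : S ⊆ U) (g : Finset (Fin n) → ℝ) :
    subsetExp q U (fun Λ => if S ⊆ Λ then g (Λ \ S) else 0)
      = q ^ S.card * subsetExp q (U \ S) g := by
  simp only [subsetExp, mul_ite, mul_zero]
  rw [← sum_filter, mul_sum]
  refine sum_nbij' (fun Λ => Λ \ S) (fun Λ => Λ ∪ S) ?_ ?_ ?_ ?_ ?_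
  · intro Λ h
    simp only [mem_filter, mem_powerset] at h ⊢
    exact sdiff_subset_sdiff h.1 le_rfl
  · intro Λ h
    simp only [mem_filter, mem_powerset] at h ⊢
    exact ⟨union_subset (h.trans sdiff_subset) hS, subset_union_right⟩
  · intro Λ h
    simp only [mem_filter, mem_powerset] at h
    exact sdiff_union_of_subset h.2
  · intro Λ h
    simp only [mem_powerset] at h
    rw [union_sdiff_right, Finset.sdiff_eq_self_iff_disjoint]
    exact disjoint_of_subset_left h sdiff_disjoint
  · intro Λ h
    simp only [mem_filter, mem_powerset] at h
    have h1 := card_sdiff_of_subset h.2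
    have h2 := card_le_card h.2
    have h3 := card_le_card h.1
    have h4 := card_sdiff_of_subset hS
    have h5 : (U \ S).card - (Λ \ S).card = U.card - Λ.card := by omega
    rw [h5, h1]
    have h6 : Λ.card = S.card + (Λ.card - S.card) := by omega
    nth_rw 1 [h6]
    rw [pow_add]
    ring

/-- The expectation of a sum over the nonempty `S ⊆ T ∩ Λ` is a sum over fixed sets `S`. -/
theorem subsetExp_sum_powerset (U T : Finset (Fin n))
    (g : Finset (Fin n) → Finset (Fin n) → ℝ) :
    subsetExp q U (fun Λ => ∑ S ∈ (T ∩ Λ).powerset.erase ∅, g S (Λ \ S))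
      = ∑ S ∈ (T ∩ U).powerset.erase ∅, q ^ S.card * subsetExp q (U \ S) (g S) := by
  have h1 : ∀ S ∈ (T ∩ U).powerset.erase ∅, q ^ S.card * subsetExp q (U \ S) (g S)
      = subsetExp q U (fun Λ => if S ⊆ Λ then g S (Λ \ S) else 0) := by
    intro S hS
    rw [mem_erase, mem_powerset] at hS
    rw [subsetExp_indicator U S (hS.2.trans inter_subset_right)]
  rw [sum_congr rfl h1, ← subsetExp_sum]
  refine sum_congr rfl fun Λ hΛ => ?_
  rw [mem_powerset] at hΛ
  congr 1
  beta_reduce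
  rw [← sum_filter]
  refine sum_congr ?_ fun _ _ => rfl
  ext S
  simp only [mem_erase, mem_powerset, mem_filter, subset_inter_iff]
  constructor
  · rintro ⟨h, h', h''⟩
    exact ⟨⟨h, h', h''.trans hΛ⟩, h''⟩
  · rintro ⟨⟨h, h', -⟩, h''⟩
    exact ⟨h, h', h''⟩

end subsetExp

/-! ### Decision trees -/

/-- `DepthLE r h`: the function `h` is computed by a decision tree of depth at most `r`. -/
def DepthLE {n : ℕ} : ℕ → ((Fin n → Bool) → Bool) → Prop
  | 0, h => ∀ z z', h z = h z'
  | r + 1, h => (∀ z z', h z = h z') ∨ ∃ i, ∀ c, DepthLE r (fun z => h (Function.update z i c))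

section DepthLE

variable {n : ℕ}

theorem depthLE_of_const {h : (Fin n → Bool) → Bool} (hc : ∀ z z', h z = h z') (r : ℕ) :
    DepthLE r h := by
  cases r with
  | zero => exact hc
  | succ r => exact Or.inl hc

theorem DepthLE.succ {r : ℕ} {h : (Fin n → Bool) → Bool} (hd : DepthLE r h) :
    DepthLE (r + 1) h := by
  induction r generalizing h with
  | zero => exact Or.inl hd
  | succ r ih =>
    rcases hd with hd | ⟨i, hi⟩
    · exact Or.inl hd
    · exact Or.inr ⟨i, fun c => ih (hi c)⟩

theorem DepthLE.mono {r r' : ℕ} (hr : r ≤ r') {h : (Fin n → Bool) → Bool} (hd : DepthLE r h) :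
    DepthLE r' h := by
  induction hr with
  | refl => exact hd
  | step _ ih => exact ih.succ

theorem DepthLE.not {r : ℕ} {h : (Fin n → Bool) → Bool} (hd : DepthLE r h) :
    DepthLE r (fun z => !h z) := by
  induction r generalizing h with
  | zero => exact fun z z' => congrArg _ (hd z z')
  | succ r ih =>
    rcases hd with hd | ⟨i, hi⟩
    · exact Or.inl fun z z' => congrArg _ (hd z z')
    · exact Or.inr ⟨i, fun c => ih (hi c)⟩

theorem piecewise_update_of_mem {i : Fin n} {Λ : Finset (Fin n)} (hi : i ∈ Λ)
    (z y : Fin n → Bool) (c : Bool) :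
    Λ.piecewise (Function.update z i c) y = Function.update (Λ.piecewise z y) i c := by
  conv_lhs => rw [← insert_eq_self.2 hi]
  exact piecewise_insert_update z y c

theorem piecewise_update_eq_erase {i : Fin n} {Λ : Finset (Fin n)} (hi : i ∈ Λ)
    (z y : Fin n → Bool) (c : Bool) :
    Λ.piecewise (Function.update z i c) y = (Λ.erase i).piecewise z (Function.update y i c) := by
  ext j
  by_cases hj : j = i
  · subst hj; simp [hi]
  · by_cases hS : j ∈ Λ <;> simp [hj, hS]

theorem depthLE_of_forall_piecewise {r : ℕ} (S : Finset (Fin n)) {h : (Fin n → Bool) → Bool}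
    (hd : ∀ b : Fin n → Bool, DepthLE r (fun z => h (S.piecewise b z))) :
    DepthLE (r + S.card) h := by
  induction S using Finset.induction_on generalizing h with
  | empty => simpa using hd (fun _ => false)
  | insert i S hi ih =>
    rw [card_insert_of_notMem hi, ← add_assoc]
    refine Or.inr ⟨i, fun c => ih fun b => ?_⟩
    have := hd (Function.update b i c)
    simpa only [piecewise_insert_update] using this

/-- A function of decision-tree depth `r` has at each point a certificate of size at most `r`. -/
theorem DepthLE.exists_certificate {r : ℕ} {h : (Fin n → Bool) → Bool} (hd : DepthLE r h)
    (y : Fin n → Bool) :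
    ∃ D : Finset (Fin n), D.card ≤ r ∧ ∀ z, (∀ i ∈ D, z i = y i) → h z = h y := by
  induction r generalizing h with
  | zero => exact ⟨∅, by simp, fun z _ => hd _ _⟩
  | succ r ih =>
    rcases hd with hd | ⟨i, hi⟩
    · exact ⟨∅, by simp, fun z _ => hd _ _⟩
    · obtain ⟨D, hD, hz⟩ := ih (hi (y i))
      refine ⟨insert i D, (card_insert_le _ _).trans (by omega), fun z hzy => ?_⟩
      have h1 := hz z fun j hj => hzy j (mem_insert_of_mem hj)
      have h2 : z i = y i := hzy i (mem_insert_self i D)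
      rw [Function.update_eq_self, ← h2, Function.update_eq_self] at h1
      exact h1

theorem depthLE_card (h : (Fin n → Bool) → Bool) : DepthLE n h := by
  have := depthLE_of_forall_piecewise (r := 0) (univ : Finset (Fin n)) (h := h)
    (fun b => depthLE_of_const (fun z z' => by simp) 0)
  simpa using this

end DepthLE

/-! ### The switching lemma -/

/-- A satisfiable term, encoded as the set of its variables and an assignment that gives them the
values required by the term. -/
abbrev Term (n : ℕ) : Type := Finset (Fin n) × (Fin n → Bool)

/-- The assignment `y` satisfies the term `T`. -/
def Term.Sat {n : ℕ} (T : Term n) (y : Fin n → Bool) : Prop := ∀ i ∈ T.1, y i = T.2 i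

instance {n : ℕ} (T : Term n) (y : Fin n → Bool) : Decidable (T.Sat y) :=
  inferInstanceAs (Decidable (∀ i ∈ T.1, y i = T.2 i))

/-- The disjunction of a list of terms. -/
def termsEval {n : ℕ} (F : List (Term n)) (y : Fin n → Bool) : Bool :=
  decide (∃ T ∈ F, T.Sat y)

/-- A weighted count of the paths of the canonical decision tree of the DNF `F` on which more than
`ℓ` variables are queried, as seen from a complete assignment `y` instead of a restriction.

`V` is the set of variables queried so far and `Λ` the set of free ones. The canonical tree goes
through the terms of `F` and queries the free variables `S` of a term that is not yet falsified.
Here `y` gives these variables the values that satisfy the term, so the relevant terms are those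
that `y` satisfies, while `S` and the answers `b` on the path are summed over (`4 ^ |S|` is `2 ^ |S|`,
for the sum over `b` as an average, times another `2 ^ |S|`, the inverse of the probability that a
uniform `y` has the satisfying values on `S`). Once `|V ∪ S| > ℓ`, the sum of `G` over all
assignments to the queried variables is taken. -/
noncomputable def pathSum {n : ℕ} (ℓ : ℕ) (G : Finset (Fin n) → (Fin n → Bool) → ℝ) :
    List (Term n) → Finset (Fin n) → Finset (Fin n) → (Fin n → Bool) → ℝ
  | [], _, _, _ => 0
  | T :: F, V, Λ, y =>
    if T.Sat y then
      ∑ S ∈ (T.1 ∩ Λ).powerset.erase ∅, 4 ^ S.card * 𝔼 b : Fin n → Bool,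
        if ℓ < (V ∪ S).card then
          2 ^ (V ∪ S).card * 𝔼 a : Fin n → Bool,
            G (Λ \ S) ((V ∪ S).piecewise a (S.piecewise b y))
        else pathSum ℓ G F (V ∪ S) (Λ \ S) (S.piecewise b y)
    else pathSum ℓ G F V Λ y

section switching

variable {n : ℕ} {ℓ : ℕ} {G : Finset (Fin n) → (Fin n → Bool) → ℝ}

theorem pathSum_nonneg (hG : ∀ Λ y, 0 ≤ G Λ y) (F : List (Term n)) (V Λ : Finset (Fin n))
    (y : Fin n → Bool) : 0 ≤ pathSum ℓ G F V Λ y := by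
  induction F generalizing V Λ y with
  | nil => exact le_rfl
  | cons T F ih =>
    rw [pathSum]
    split_ifs
    · refine sum_nonneg fun S _ => mul_nonneg (by positivity) (expect_nonneg fun b _ => ?_)
      split_ifs
      · exact mul_nonneg (by positivity) (expect_nonneg fun a _ => hG _ _)
      · exact ih _ _ _
    · exact ih _ _ _

theorem sum_pow_card_powerset_erase_le {k : ℕ} (hk : 1 ≤ k) (T : Finset (Fin n))
    (hT : T.card ≤ k) :
    ∑ S ∈ T.powerset.erase ∅, (1 / (2 * k : ℝ)) ^ S.card ≤ 1 := by
  have hk' : (0 : ℝ) < k := by exact_mod_cast hk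
  have h1 : ∑ S ∈ T.powerset, (1 / (2 * k : ℝ)) ^ S.card = (1 / (2 * k : ℝ) + 1) ^ T.card := by
    rw [← Finset.sum_pow_mul_eq_add_pow]
    simp
  have h2 : (1 / (2 * k : ℝ) + 1) ^ T.card ≤ 2 := by
    calc (1 / (2 * k : ℝ) + 1) ^ T.card
        ≤ (1 / (2 * k : ℝ) + 1) ^ k :=
          pow_le_pow_right₀ (le_add_of_nonneg_left (by positivity)) hT
      _ ≤ (Real.exp (1 / (2 * k : ℝ))) ^ k :=
          pow_le_pow_left₀ (by positivity) (Real.add_one_le_exp _) k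
      _ = Real.exp (1 / 2) := by
          rw [← Real.exp_nat_mul]
          congr 1
          field_simp
      _ ≤ 2 := by
          have h3 : Real.exp (1 / 2) ^ 2 = Real.exp 1 := by
            rw [← Real.exp_nat_mul]; norm_num
          have := Real.exp_one_lt_d9
          have := Real.exp_pos (1 / 2)
          nlinarith
  have h3 := add_sum_erase T.powerset (fun S => (1 / (2 * k : ℝ)) ^ S.card) (empty_mem_powerset T)
  simp only [card_empty, pow_zero] at h3
  linarith

/-- For every fixed `y`, a random set `Λ` that keeps each variable with probability `1 / (32 k)`
contains the queried variables of a long path with small probability: each step of a path sums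
`(16 / (32 k)) ^ |S|` over the nonempty subsets `S` of a term of width `k`, which is at most `1`. -/
theorem subsetExp_pathSum_le {k : ℕ} (hk : 1 ≤ k) {D : ℝ} (hD : 0 ≤ D)
    (hG : ∀ U y, subsetExp (1 / (32 * k : ℝ)) U (fun Λ => G Λ y) ≤ D)
    (F : List (Term n)) (hF : ∀ T ∈ F, T.1.card ≤ k) (V U : Finset (Fin n)) (y : Fin n → Bool) :
    subsetExp (1 / (32 * k : ℝ)) U (fun Λ => pathSum ℓ G F V Λ y)
      ≤ D * 4 ^ V.card / 2 ^ (ℓ + 1) := by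
  have hk' : (0 : ℝ) < k := by exact_mod_cast hk
  induction F generalizing V U y with
  | nil =>
    simp only [pathSum]
    rw [subsetExp_const]
    positivity
  | cons T F ih =>
    have ih' := fun V U y => ih (fun T hT => hF T (List.mem_cons_of_mem _ hT)) V U y
    by_cases hT : T.Sat y
    · simp only [pathSum, hT, if_true]
      rw [subsetExp_sum_powerset U T.1 (fun S Λ => 4 ^ S.card * 𝔼 b : Fin n → Bool,
        if ℓ < (V ∪ S).card then
          2 ^ (V ∪ S).card * 𝔼 a : Fin n → Bool,
            G Λ ((V ∪ S).piecewise a (S.piecewise b y))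
        else pathSum ℓ G F (V ∪ S) Λ (S.piecewise b y))]
      have key : ∀ S : Finset (Fin n), ∀ b : Fin n → Bool,
          subsetExp (1 / (32 * k : ℝ)) (U \ S) (fun Λ => if ℓ < (V ∪ S).card then
            2 ^ (V ∪ S).card * 𝔼 a : Fin n → Bool,
              G Λ ((V ∪ S).piecewise a (S.piecewise b y))
            else pathSum ℓ G F (V ∪ S) Λ (S.piecewise b y))
          ≤ D * 4 ^ V.card / 2 ^ (ℓ + 1) * 4 ^ S.card := by
        intro S b
        have h4 : D * 4 ^ (V ∪ S).card / 2 ^ (ℓ + 1)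
            ≤ D * 4 ^ V.card / 2 ^ (ℓ + 1) * 4 ^ S.card := by
          rw [div_mul_eq_mul_div, mul_assoc, ← pow_add]
          gcongr
          · norm_num
          · exact card_union_le V S
        refine le_trans ?_ h4
        by_cases hl : ℓ < (V ∪ S).card
        · simp only [hl, if_true]
          rw [subsetExp_mul_left, subsetExp_expect]
          have h5 : 𝔼 a : Fin n → Bool, subsetExp (1 / (32 * k : ℝ)) (U \ S)
              (fun Λ => G Λ ((V ∪ S).piecewise a (S.piecewise b y))) ≤ D :=
            expect_le univ_nonempty fun a _ => hG _ _
          calc _ ≤ 2 ^ (V ∪ S).card * D := by gcongr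
            _ ≤ D * 4 ^ (V ∪ S).card / 2 ^ (ℓ + 1) := by
              rw [le_div_iff₀ (by positivity)]
              have h6 : (2 : ℝ) ^ (ℓ + 1) ≤ 2 ^ (V ∪ S).card :=
                pow_le_pow_right₀ (by norm_num) hl
              have h7 : (4 : ℝ) ^ (V ∪ S).card = 2 ^ (V ∪ S).card * 2 ^ (V ∪ S).card := by
                rw [← mul_pow]; norm_num
              rw [h7, mul_comm (2 ^ (V ∪ S).card) D, mul_assoc]
              gcongr
        · simp only [hl, if_false]
          exact ih' _ _ _
      calc _ ≤ ∑ S ∈ (T.1 ∩ U).powerset.erase ∅,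
            D * 4 ^ V.card / 2 ^ (ℓ + 1) * (1 / (2 * k : ℝ)) ^ S.card := by
            refine sum_le_sum fun S _ => ?_
            rw [subsetExp_mul_left, subsetExp_expect]
            have h5 := expect_le (univ_nonempty (α := Fin n → Bool)) fun b _ => key S b
            calc _ ≤ (1 / (32 * k : ℝ)) ^ S.card *
                  (4 ^ S.card * (D * 4 ^ V.card / 2 ^ (ℓ + 1) * 4 ^ S.card)) := by gcongr
              _ = D * 4 ^ V.card / 2 ^ (ℓ + 1) * ((1 / (32 * k : ℝ)) * 4 * 4) ^ S.card := by
                rw [mul_pow, mul_pow]; ring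
              _ = _ := by
                congr 2
                field_simp
                norm_num
        _ ≤ D * 4 ^ V.card / 2 ^ (ℓ + 1) * 1 := by
            rw [← mul_sum]
            have := sum_pow_card_powerset_erase_le hk (T.1 ∩ U)
              ((card_le_card inter_subset_left).trans (hF T List.mem_cons_self))
            gcongr
        _ = _ := mul_one _
    · simp only [pathSum, hT, if_false]
      exact ih' V U y

/-- If the DNF `F` is still deep on the subcube `(Λ, y)`, then its canonical tree has a long path,
and this path is counted by `pathSum` at the completions of `(Λ, y)`. Here `w` is any quantity that
is bounded by the sum of `G` over the assignments to the variables queried on a path. -/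
theorem le_expect_pathSum (hG : ∀ Λ y, 0 ≤ G Λ y) (w : ℝ) (F : List (Term n))
    (V Λ : Finset (Fin n)) (y : Fin n → Bool) (hVΛ : Disjoint V Λ) (hV : V.card ≤ ℓ)
    (hdeep : ¬ DepthLE (ℓ - V.card) (fun z => termsEval F (Λ.piecewise z y)))
    (hw : ∀ S ⊆ Λ, S.Nonempty → w ≤ 2 ^ (V ∪ S).card *
      𝔼 a : Fin n → Bool, 𝔼 z : Fin n → Bool,
        G (Λ \ S) ((Λ \ S).piecewise z ((V ∪ S).piecewise a y))) :
    w ≤ 𝔼 z : Fin n → Bool, pathSum ℓ G F V Λ (Λ.piecewise z y) := by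
  induction F generalizing V Λ y with
  | nil => exact absurd (depthLE_of_const (fun z z' => by simp [termsEval]) _) hdeep
  | cons T F ih =>
    by_cases hT : ∃ i ∈ T.1, i ∉ Λ ∧ y i ≠ T.2 i
    · obtain ⟨i, hiT, hiΛ, hi⟩ := hT
      have h1 : ∀ z : Fin n → Bool, ¬ T.Sat (Λ.piecewise z y) := by
        intro z h
        have := h i hiT
        rw [piecewise_eq_of_notMem _ _ _ hiΛ] at this
        exact hi this
      have h2 : ∀ z : Fin n → Bool, termsEval (T :: F) (Λ.piecewise z y)
          = termsEval F (Λ.piecewise z y) := by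
        intro z
        simp [termsEval, h1 z]
      simp only [h2] at hdeep
      simp only [pathSum, h1, if_false]
      exact ih V Λ y hVΛ hV hdeep hw
    · push Not at hT
      set S := T.1 ∩ Λ with hS
      have hSΛ : S ⊆ Λ := inter_subset_right
      have hsat : ∀ z : Fin n → Bool, (∀ i ∈ S, z i = T.2 i) → T.Sat (Λ.piecewise z y) := by
        intro z hz i hi
        by_cases hiΛ : i ∈ Λ
        · rw [piecewise_eq_of_mem _ _ _ hiΛ]
          exact hz i (mem_inter.2 ⟨hi, hiΛ⟩)
        · rw [piecewise_eq_of_notMem _ _ _ hiΛ]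
          exact hT i hi hiΛ
      have hSne : S.Nonempty := by
        by_contra hemp
        rw [not_nonempty_iff_eq_empty] at hemp
        refine hdeep (depthLE_of_const (fun z z' => ?_) _)
        have h1 : ∀ z : Fin n → Bool, termsEval (T :: F) (Λ.piecewise z y) = true := by
          intro z
          simp [termsEval, hsat z (by simp [hemp])]
        rw [h1, h1]
      have hVS : Disjoint V S := disjoint_of_subset_right hSΛ hVΛ
      have hcard : (V ∪ S).card = V.card + S.card := card_union_of_disjoint hVS
      have hmerge : ∀ b z : Fin n → Bool, S.piecewise b (Λ.piecewise z y)
          = (Λ \ S).piecewise z (S.piecewise b y) := by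
        intro b z
        ext i
        by_cases hi : i ∈ S
        · simp [hi]
        · by_cases hi' : i ∈ Λ <;> simp [hi, hi']
      set next : (Fin n → Bool) → ℝ := fun u =>
        if ℓ < (V ∪ S).card then
          2 ^ (V ∪ S).card * 𝔼 a : Fin n → Bool, G (Λ \ S) ((V ∪ S).piecewise a u)
        else pathSum ℓ G F (V ∪ S) (Λ \ S) u with hnext
      have hnext0 : ∀ u, 0 ≤ next u := by
        intro u
        simp only [hnext]
        split_ifs
        · exact mul_nonneg (by positivity) (expect_nonneg fun a _ => hG _ _)
        · exact pathSum_nonneg hG _ _ _ _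
      -- Some answers `b` to the queries of `S` lead to a subcube that is deep as well.
      have hb : ∃ b : Fin n → Bool,
          w ≤ 𝔼 z : Fin n → Bool, next (S.piecewise b (Λ.piecewise z y)) := by
        by_cases hl : ℓ < (V ∪ S).card
        · refine ⟨y, (hw S hSΛ hSne).trans (le_of_eq ?_)⟩
          simp only [hnext, hl, if_true]
          rw [← mul_expect, expect_comm]
          congr 1
          refine expect_congr rfl fun z _ => expect_congr rfl fun a _ => ?_
          congr 1
          ext i
          by_cases hiV : i ∈ V
          · have := disjoint_left.1 hVΛ hiV
            simp [hiV, this]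
          · by_cases hiS : i ∈ S
            · simp [hiS]
            · by_cases hiΛ : i ∈ Λ <;> simp [hiV, hiS, hiΛ]
        · have hex : ∃ b : Fin n → Bool, ¬ DepthLE (ℓ - (V ∪ S).card)
              (fun z => termsEval (T :: F) (Λ.piecewise (S.piecewise b z) y)) := by
            by_contra hall
            push Not at hall
            refine hdeep ?_
            have h1 := depthLE_of_forall_piecewise S
              (h := fun z => termsEval (T :: F) (Λ.piecewise z y)) hall
            exact h1.mono (by omega)
          obtain ⟨b, hb⟩ := hex
          refine ⟨b, ?_⟩
          simp only [hnext, hl, if_false]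
          have hcomm : ∀ z : Fin n → Bool, Λ.piecewise (S.piecewise b z) y
              = (Λ \ S).piecewise z (S.piecewise b y) := by
            intro z
            ext i
            by_cases hi : i ∈ S
            · simp [hi, hSΛ hi]
            · by_cases hi' : i ∈ Λ <;> simp [hi, hi']
          have hbT : ¬ ∀ i ∈ S, b i = T.2 i := by
            intro hbT
            refine hb (depthLE_of_const (fun z z' => ?_) _)
            have h1 : ∀ z : Fin n → Bool,
                termsEval (T :: F) (Λ.piecewise (S.piecewise b z) y) = true := by
              intro z
              have : T.Sat (Λ.piecewise (S.piecewise b z) y) :=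
                hsat _ fun i hi => by simp [hi, hbT i hi]
              simp [termsEval, this]
            rw [h1, h1]
          have hfals : ∀ z : Fin n → Bool, ¬ T.Sat (Λ.piecewise (S.piecewise b z) y) := by
            intro z h
            refine hbT fun i hi => ?_
            have := h i (mem_inter.1 hi).1
            simpa [hi, hSΛ hi] using this
          have heval : ∀ z : Fin n → Bool,
              termsEval (T :: F) (Λ.piecewise (S.piecewise b z) y)
                = termsEval F ((Λ \ S).piecewise z (S.piecewise b y)) := by
            intro z
            rw [← hcomm z]
            simp [termsEval, hfals z]
          simp only [heval] at hb
          simp only [hmerge]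
          refine ih (V ∪ S) (Λ \ S) (S.piecewise b y) ?_ (not_lt.1 hl) hb ?_
          · rw [disjoint_union_left]
            exact ⟨disjoint_of_subset_right sdiff_subset hVΛ, disjoint_sdiff⟩
          · intro S' hS' hne'
            have h1 := hw (S ∪ S') (union_subset hSΛ (hS'.trans sdiff_subset))
              (hne'.mono subset_union_right)
            refine h1.trans (le_of_eq ?_)
            have h2 : Λ \ (S ∪ S') = (Λ \ S) \ S' := by
              ext i
              simp only [mem_sdiff, mem_union]
              tauto
            rw [← union_assoc, h2]
            congr 1
            refine expect_congr rfl fun a _ => expect_congr rfl fun z _ => ?_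
            congr 2
            ext i
            by_cases hi : i ∈ S <;> simp [Finset.piecewise, hi]
      obtain ⟨b, hb⟩ := hb
      have hge : ∀ z : Fin n → Bool, (∀ i ∈ S, z i = T.2 i) →
          2 ^ S.card * next (S.piecewise b (Λ.piecewise z y))
            ≤ pathSum ℓ G (T :: F) V Λ (Λ.piecewise z y) := by
        intro z hz
        rw [pathSum, if_pos (hsat z hz)]
        have hterm : (4 : ℝ) ^ S.card * 𝔼 b : Fin n → Bool,
              next (S.piecewise b (Λ.piecewise z y))
            ≤ ∑ S ∈ (T.1 ∩ Λ).powerset.erase ∅, 4 ^ S.card * 𝔼 b : Fin n → Bool,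
              if ℓ < (V ∪ S).card then
                2 ^ (V ∪ S).card * 𝔼 a : Fin n → Bool,
                  G (Λ \ S) ((V ∪ S).piecewise a (S.piecewise b (Λ.piecewise z y)))
              else pathSum ℓ G F (V ∪ S) (Λ \ S) (S.piecewise b (Λ.piecewise z y)) := by
          refine single_le_sum (f := fun S : Finset (Fin n) =>
            (4 : ℝ) ^ S.card * 𝔼 b : Fin n → Bool,
              if ℓ < (V ∪ S).card then
                2 ^ (V ∪ S).card * 𝔼 a : Fin n → Bool,
                  G (Λ \ S) ((V ∪ S).piecewise a (S.piecewise b (Λ.piecewise z y)))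
              else pathSum ℓ G F (V ∪ S) (Λ \ S) (S.piecewise b (Λ.piecewise z y))) ?_
            (a := S) ?_
          · intro S' _
            refine mul_nonneg (by positivity) (expect_nonneg fun b _ => ?_)
            split_ifs
            · exact mul_nonneg (by positivity) (expect_nonneg fun a _ => hG _ _)
            · exact pathSum_nonneg hG _ _ _ _
          · exact mem_erase.2 ⟨hSne.ne_empty, mem_powerset.2 le_rfl⟩
        refine le_trans ?_ hterm
        have h1 := le_two_pow_mul_expect S hnext0 b (Λ.piecewise z y)
        have h4 : (4 : ℝ) ^ S.card = 2 ^ S.card * 2 ^ S.card := by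
          rw [← mul_pow]; norm_num
        rw [h4, mul_assoc]
        gcongr
      -- Only the completions that satisfy `T`, a fraction `2 ^ (-|S|)` of all, are used.
      have hpt : ∀ z : Fin n → Bool, next (S.piecewise b (Λ.piecewise z y))
          ≤ 𝔼 a : Fin n → Bool,
            pathSum ℓ G (T :: F) V Λ (Λ.piecewise (S.piecewise a z) y) := by
        intro z
        have h1 := hge (S.piecewise T.2 z) (fun i hi => by simp [hi])
        have h2 := le_two_pow_mul_expect S
          (h := fun u => pathSum ℓ G (T :: F) V Λ (Λ.piecewise u y))
          (fun u => pathSum_nonneg hG _ _ _ _) T.2 z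
        have h3 : S.piecewise b (Λ.piecewise (S.piecewise T.2 z) y)
            = S.piecewise b (Λ.piecewise z y) := by
          ext i
          by_cases hi : i ∈ S
          · simp [hi]
          · by_cases hi' : i ∈ Λ <;> simp [hi, hi']
        rw [h3] at h1
        exact le_of_mul_le_mul_left (h1.trans h2) (by positivity)
      calc w ≤ _ := hb
        _ ≤ 𝔼 z : Fin n → Bool, 𝔼 a : Fin n → Bool,
            pathSum ℓ G (T :: F) V Λ (Λ.piecewise (S.piecewise a z) y) :=
          expect_le_expect fun z _ => hpt z
        _ = _ := by
          rw [expect_comm]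
          exact expect_expect_piecewise S (fun u => pathSum ℓ G (T :: F) V Λ (Λ.piecewise u y))

/-- The bound for the number of leaves of a common partial decision tree of the DNFs `F i`, as seen
from a complete assignment. As long as some `F i` has no decision tree of depth `ℓ`, the common tree
queries all the variables on a long path of its canonical tree; since the assignment alone does not
tell which `i` this is, all `i` are summed over. There are at most `r` such rounds, and `A` is the
weight of a leaf. -/
noncomputable def switchingSum {ι : Type} [Fintype ι] (ℓ : ℕ) (F : ι → List (Term n)) (A : ℝ) :
    ℕ → Finset (Fin n) → (Fin n → Bool) → ℝ
  | 0, _, _ => A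
  | r + 1, Λ, y => A + ∑ i, pathSum ℓ (switchingSum ℓ F A r) (F i) ∅ Λ y

variable {ι : Type} [Fintype ι] {F : ι → List (Term n)} {A : ℝ}

theorem switchingSum_nonneg (hA : 0 ≤ A) (r : ℕ) (Λ : Finset (Fin n)) (y : Fin n → Bool) :
    0 ≤ switchingSum ℓ F A r Λ y := by
  induction r generalizing Λ y with
  | zero => exact hA
  | succ r ih => exact add_nonneg hA (sum_nonneg fun i _ => pathSum_nonneg ih _ _ _ _)

theorem subsetExp_switchingSum_le {k : ℕ} (hk : 1 ≤ k) (hA : 0 ≤ A)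
    (hF : ∀ i, ∀ T ∈ F i, T.1.card ≤ k) (hι : Fintype.card ι ≤ 2 ^ ℓ) (r : ℕ)
    (U : Finset (Fin n)) (y : Fin n → Bool) :
    subsetExp (1 / (32 * k : ℝ)) U (fun Λ => switchingSum ℓ F A r Λ y) ≤ 2 * A := by
  induction r generalizing U y with
  | zero =>
    simp only [switchingSum]
    rw [subsetExp_const]
    linarith
  | succ r ih =>
    simp only [switchingSum]
    rw [subsetExp_add, subsetExp_const, subsetExp_sum]
    have h1 : ∀ i ∈ (univ : Finset ι), subsetExp (1 / (32 * k : ℝ)) U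
        (fun Λ => pathSum ℓ (switchingSum ℓ F A r) (F i) ∅ Λ y) ≤ A / 2 ^ ℓ := by
      intro i _
      refine (subsetExp_pathSum_le hk (by linarith) ih (F i) (hF i) ∅ U y).trans (le_of_eq ?_)
      rw [card_empty, pow_succ]
      field_simp
    have h2 := sum_le_card_nsmul _ _ _ h1
    rw [nsmul_eq_mul, card_univ] at h2
    have h3 : (Fintype.card ι : ℝ) * (A / 2 ^ ℓ) ≤ A := by
      rw [mul_div_assoc', div_le_iff₀ (by positivity), mul_comm]
      have : (Fintype.card ι : ℝ) ≤ 2 ^ ℓ := by exact_mod_cast hι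
      gcongr
    linarith

/-- Pointwise domination: on each subcube with at most `r` free variables, a subadditive `ω` that is
at most `A` on shallow subcubes is bounded by the average of `switchingSum` over the subcube. -/
theorem le_expect_switchingSum (hA : 0 ≤ A) {U : Finset (Fin n)}
    {ω : Finset (Fin n) → (Fin n → Bool) → ℝ}
    (hsplit : ∀ Λ ⊆ U, ∀ y, ∀ i ∈ Λ,
      ω Λ y ≤ ∑ c : Bool, ω (Λ.erase i) (Function.update y i c))
    (hω : ∀ Λ ⊆ U, ∀ y,
      (∀ i, DepthLE ℓ (fun z => termsEval (F i) (Λ.piecewise z y))) → ω Λ y ≤ A)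
    (r : ℕ) (Λ : Finset (Fin n)) (hΛ : Λ ⊆ U) (hr : Λ.card ≤ r) (y : Fin n → Bool) :
    ω Λ y ≤ 𝔼 z : Fin n → Bool, switchingSum ℓ F A r Λ (Λ.piecewise z y) := by
  have hbase : ∀ r Λ, ∀ y : Fin n → Bool,
      A ≤ 𝔼 z : Fin n → Bool, switchingSum ℓ F A r Λ (Λ.piecewise z y) := by
    intro r Λ y
    refine le_expect univ_nonempty fun z _ => ?_
    cases r with
    | zero => exact le_rfl
    | succ r =>
      exact le_add_of_nonneg_right
        (sum_nonneg fun i _ => pathSum_nonneg (switchingSum_nonneg hA r) _ _ _ _)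
  induction r generalizing Λ y with
  | zero =>
    have h0 : Λ = ∅ := card_eq_zero.1 (by omega)
    subst h0
    refine (hω ∅ hΛ y fun i => ?_).trans (hbase _ _ _)
    exact depthLE_of_const (fun z z' => by simp) _
  | succ r ih =>
    by_cases hsh : ∀ i, DepthLE ℓ (fun z => termsEval (F i) (Λ.piecewise z y))
    · exact (hω Λ hΛ y hsh).trans (hbase _ _ _)
    · push Not at hsh
      obtain ⟨i, hi⟩ := hsh
      have hG := switchingSum_nonneg (ℓ := ℓ) (F := F) hA r
      refine (le_expect_pathSum hG (ω Λ y) (F i) ∅ Λ y (disjoint_empty_left _) (by simp)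
        (by simpa using hi) ?_).trans (expect_le_expect fun z _ => ?_)
      · intro S hS hne
        rw [empty_union]
        refine (le_two_pow_mul_expect_of_split hsplit hΛ S hS y).trans ?_
        refine mul_le_mul_of_nonneg_left (expect_le_expect fun a _ => ?_) (by positivity)
        have := card_sdiff_of_subset hS
        have := hne.card_pos
        exact ih (Λ \ S) (sdiff_subset.trans hΛ) (by omega) _
      · rw [switchingSum]
        have := single_le_sum (f := fun i =>
          pathSum ℓ (switchingSum ℓ F A r) (F i) ∅ Λ (Λ.piecewise z y))
          (fun i _ => pathSum_nonneg hG _ _ _ _) (mem_univ i)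
        linarith

/-- The multi-switching lemma, in expectation. Let `ω` be a subadditive functional of subcubes that
is at most `A` where all of the at most `2 ^ ℓ` many `k`-DNFs `F i` have decision trees of depth `ℓ`.
Then its expectation over a random subcube, which leaves each variable free with probability
`1 / (32 k)`, is at most `2 A`. -/
theorem subsetExp_expect_le {k : ℕ} (hk : 1 ≤ k) (hA : 0 ≤ A)
    (hF : ∀ i, ∀ T ∈ F i, T.1.card ≤ k) (hι : Fintype.card ι ≤ 2 ^ ℓ)
    {U : Finset (Fin n)} {ω : Finset (Fin n) → (Fin n → Bool) → ℝ}
    (hsplit : ∀ Λ ⊆ U, ∀ y, ∀ i ∈ Λ,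
      ω Λ y ≤ ∑ c : Bool, ω (Λ.erase i) (Function.update y i c))
    (hω : ∀ Λ ⊆ U, ∀ y,
      (∀ i, DepthLE ℓ (fun z => termsEval (F i) (Λ.piecewise z y))) → ω Λ y ≤ A) :
    subsetExp (1 / (32 * k : ℝ)) U (fun Λ => 𝔼 y : Fin n → Bool, ω Λ y) ≤ 2 * A := by
  have hk' : (1 : ℝ) ≤ k := by exact_mod_cast hk
  have hq0 : 0 ≤ 1 / (32 * k : ℝ) := by positivity
  have hq1 : 1 / (32 * k : ℝ) ≤ 1 := by
    rw [div_le_one (by positivity)]; linarith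
  calc _ ≤ subsetExp (1 / (32 * k : ℝ)) U
        (fun Λ => 𝔼 y : Fin n → Bool, switchingSum ℓ F A n Λ y) := by
        refine subsetExp_mono hq0 hq1 fun Λ hΛ => ?_
        rw [← expect_expect_piecewise Λ (fun y => switchingSum ℓ F A n Λ y), expect_comm]
        refine expect_le_expect fun y _ => ?_
        exact le_expect_switchingSum hA hsplit hω n Λ hΛ
          (by simpa using card_le_univ Λ) y
    _ ≤ 2 * A := by
        rw [subsetExp_expect]
        exact expect_le univ_nonempty fun y _ => subsetExp_switchingSum_le hk hA hF hι n U y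

end switching

/-! ### The size of decision trees -/

/-- `HasTree h N`: the function `h` is computed by a decision tree with exactly `N` leaves. -/
inductive HasTree {n : ℕ} : ((Fin n → Bool) → Bool) → ℕ → Prop
  | const {h : (Fin n → Bool) → Bool} (hc : ∀ z z', h z = h z') : HasTree h 1
  | node {h : (Fin n → Bool) → Bool} (i : Fin n) {N₀ N₁ : ℕ}
      (h₀ : HasTree (fun z => h (Function.update z i false)) N₀)
      (h₁ : HasTree (fun z => h (Function.update z i true)) N₁) : HasTree h (N₀ + N₁)

/-- The least number of leaves of a decision tree that computes `h`. -/
noncomputable def treeSize {n : ℕ} (h : (Fin n → Bool) → Bool) : ℕ := sInf {N | HasTree h N}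

section treeSize

variable {n : ℕ}

theorem DepthLE.exists_hasTree {r : ℕ} {h : (Fin n → Bool) → Bool} (hd : DepthLE r h) :
    ∃ N, HasTree h N := by
  induction r generalizing h with
  | zero => exact ⟨1, .const hd⟩
  | succ r ih =>
    rcases hd with hd | ⟨i, hi⟩
    · exact ⟨1, .const hd⟩
    · obtain ⟨N₀, h₀⟩ := ih (hi false)
      obtain ⟨N₁, h₁⟩ := ih (hi true)
      exact ⟨_, .node i h₀ h₁⟩

/-- The infimum in `treeSize` is attained: every function has a decision tree. -/
theorem hasTree_treeSize (h : (Fin n → Bool) → Bool) : HasTree h (treeSize h) :=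
  Nat.sInf_mem (depthLE_card h).exists_hasTree

theorem treeSize_le {h : (Fin n → Bool) → Bool} {N : ℕ} (hN : HasTree h N) : treeSize h ≤ N :=
  Nat.sInf_le hN

theorem treeSize_le_sum (h : (Fin n → Bool) → Bool) (i : Fin n) :
    treeSize h ≤ ∑ c : Bool, treeSize (fun z => h (Function.update z i c)) := by
  rw [Fintype.sum_bool, add_comm]
  exact treeSize_le (.node i (hasTree_treeSize _) (hasTree_treeSize _))

theorem treeSize_restrict_le_sum (f : (Fin n → Bool) → Bool) (Λ : Finset (Fin n))
    (y : Fin n → Bool) {i : Fin n} (hi : i ∈ Λ) :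
    treeSize (fun z => f (Λ.piecewise z y))
      ≤ ∑ c : Bool, treeSize (fun z => f ((Λ.erase i).piecewise z (Function.update y i c))) := by
  refine (treeSize_le_sum _ i).trans (le_of_eq ?_)
  simp only [piecewise_update_eq_erase hi]

end treeSize

/-- Every point where `h` is true has a certificate of size at most `k` for this. -/
def HasCertificates {n : ℕ} (k : ℕ) (h : (Fin n → Bool) → Bool) : Prop :=
  ∀ y, h y = true → ∃ D : Finset (Fin n), D.card ≤ k ∧ ∀ z, (∀ i ∈ D, z i = y i) → h z = true

section step

variable {n : ℕ}

theorem HasCertificates.exists_terms {k : ℕ} {h : (Fin n → Bool) → Bool}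
    (hc : HasCertificates k h) :
    ∃ F : List (Term n), (∀ T ∈ F, T.1.card ≤ k) ∧ ∀ z, termsEval F z = h z := by
  have h1 : ∀ y, ∃ D : Finset (Fin n), h y = true →
      D.card ≤ k ∧ ∀ z, (∀ i ∈ D, z i = y i) → h z = true := by
    intro y
    by_cases hy : h y = true
    · obtain ⟨D, hD⟩ := hc y hy
      exact ⟨D, fun _ => hD⟩
    · exact ⟨∅, fun h => absurd h hy⟩
  choose D hD using h1
  refine ⟨((univ.filter fun y => h y = true).toList.map fun y => (D y, y)), ?_, ?_⟩
  · intro T hT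
    obtain ⟨y, hy, rfl⟩ := List.mem_map.1 hT
    rw [mem_toList, mem_filter] at hy
    exact (hD y hy.2).1
  · intro z
    rw [Bool.eq_iff_iff, termsEval, decide_eq_true_iff]
    constructor
    · rintro ⟨T, hT, hsat⟩
      obtain ⟨y, hy, rfl⟩ := List.mem_map.1 hT
      rw [mem_toList, mem_filter] at hy
      exact (hD y hy.2).2 z hsat
    · intro hz
      exact ⟨(D z, z), List.mem_map.2 ⟨z, by simpa using hz, rfl⟩, fun _ _ => rfl⟩

/-- One switching step for tree sizes. The weight `((1 + p) / 2) ^ |Λ|` is chosen such that averaging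
`(1 + p) ^ |Λ|` over `Λ ⊆ U` with density `q = 1 / (32 k)` gives exactly `(1 + q p) ^ |U|`, so that a
bound with parameter `p` on the shallow subcubes turns into a bound with parameter `q p`. -/
theorem treeSize_mul_pow_le {k ℓ : ℕ} (hk : 1 ≤ k) {ι : Type} [Fintype ι]
    (hι : Fintype.card ι ≤ 2 ^ ℓ) (f : (Fin n → Bool) → Bool) (g : ι → (Fin n → Bool) → Bool)
    (U : Finset (Fin n)) (x : Fin n → Bool)
    (hg : ∀ i, HasCertificates k (fun z => g i (U.piecewise z x)) ∨
      HasCertificates k (fun z => !g i (U.piecewise z x)))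
    {p A : ℝ} (hp0 : 0 ≤ p) (hp1 : p ≤ 1) (hA : 0 ≤ A)
    (hstep : ∀ (Λ : Finset (Fin n)) (y : Fin n → Bool),
      (∀ i, DepthLE ℓ (fun z => g i (Λ.piecewise z y))) →
        (treeSize (fun z => f (Λ.piecewise z y)) : ℝ) * ((1 + p) / 2) ^ Λ.card ≤ A) :
    (treeSize (fun z => f (U.piecewise z x)) : ℝ) * ((1 + 1 / (32 * k) * p) / 2) ^ U.card
      ≤ 2 * A := by
  have hF : ∀ i, ∃ F : List (Term n), (∀ T ∈ F, T.1.card ≤ k) ∧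
      ((∀ z, termsEval F z = g i (U.piecewise z x)) ∨
        ∀ z, termsEval F z = !g i (U.piecewise z x)) := by
    intro i
    rcases hg i with h | h
    · obtain ⟨F, h1, h2⟩ := h.exists_terms
      exact ⟨F, h1, Or.inl h2⟩
    · obtain ⟨F, h1, h2⟩ := h.exists_terms
      exact ⟨F, h1, Or.inr h2⟩
  choose F hFk hFg using hF
  have hk' : (1 : ℝ) ≤ k := by exact_mod_cast hk
  have hq0 : 0 ≤ 1 / (32 * k : ℝ) := by positivity
  have hq1 : 1 / (32 * k : ℝ) ≤ 1 := by
    rw [div_le_one (by positivity)]; linarith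
  -- The switching lemma is about functions on the whole cube, hence `x` is merged into `y`.
  set ω : Finset (Fin n) → (Fin n → Bool) → ℝ := fun Λ y =>
    (treeSize (fun z => f (Λ.piecewise z (U.piecewise y x))) : ℝ) * ((1 + p) / 2) ^ Λ.card with hω
  have hmain : subsetExp (1 / (32 * k : ℝ)) U (fun Λ => 𝔼 y : Fin n → Bool, ω Λ y) ≤ 2 * A := by
    refine subsetExp_expect_le (ℓ := ℓ) (F := F) hk hA hFk hι ?_ ?_
    · intro Λ hΛ y i hi
      have h1 := treeSize_restrict_le_sum f Λ (U.piecewise y x) hi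
      have h2 : (treeSize (fun z => f (Λ.piecewise z (U.piecewise y x))) : ℝ) ≤ ∑ c : Bool,
          (treeSize (fun z => f ((Λ.erase i).piecewise z
            (U.piecewise (Function.update y i c) x))) : ℝ) := by
        simp only [piecewise_update_of_mem (hΛ hi)]
        exact_mod_cast h1
      simp only [hω]
      rw [← sum_mul]
      refine mul_le_mul h2 ?_ (by positivity) (sum_nonneg fun c _ => by positivity)
      exact pow_le_pow_of_le_one (by positivity) (by linarith) (card_le_card (erase_subset i Λ))
    · intro Λ hΛ y hsh
      refine hstep Λ (U.piecewise y x) fun i => ?_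
      have hmerge : ∀ z : Fin n → Bool, U.piecewise (Λ.piecewise z y) x
          = Λ.piecewise z (U.piecewise y x) := by
        intro z
        ext j
        by_cases hj : j ∈ Λ
        · simp [hj, hΛ hj]
        · by_cases hj' : j ∈ U <;> simp [hj, hj']
      have h1 := hsh i
      rcases hFg i with h | h
      · simpa only [h, hmerge] using h1
      · have h2 := h1.not
        simpa only [h, hmerge, Bool.not_not] using h2
  -- Splitting along the variables outside `Λ` bounds the tree size for each fixed `Λ`.
  have hfix : ∀ Λ ⊆ U, (treeSize (fun z => f (U.piecewise z x)) : ℝ) / 2 ^ U.card *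
      (1 + p) ^ Λ.card ≤ 𝔼 y : Fin n → Bool, ω Λ y := by
    intro Λ hΛ
    have h1 := le_two_pow_mul_expect_of_split (U := U)
      (ω := fun Λ y => (treeSize (fun z => f (Λ.piecewise z y)) : ℝ))
      (fun Λ _ y i hi => by exact_mod_cast treeSize_restrict_le_sum f Λ y hi)
      (Λ := U) le_rfl (U \ Λ) sdiff_subset x
    rw [Finset.sdiff_sdiff_eq_self hΛ, card_sdiff_of_subset hΛ] at h1
    have h2 : ∀ b z : Fin n → Bool, Λ.piecewise z ((U \ Λ).piecewise b x)
        = Λ.piecewise z (U.piecewise b x) := by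
      intro b z
      ext j
      by_cases hj : j ∈ Λ
      · simp [hj]
      · by_cases hj' : j ∈ U <;> simp [hj, hj']
    simp only [h2] at h1
    simp only [hω, ← expect_mul]
    have h3 : (2 : ℝ) ^ U.card = 2 ^ (U.card - Λ.card) * 2 ^ Λ.card := by
      rw [← pow_add, Nat.sub_add_cancel (card_le_card hΛ)]
    rw [h3, div_pow, div_mul_eq_mul_div, div_le_iff₀ (by positivity)]
    calc _ ≤ (2 ^ (U.card - Λ.card) * 𝔼 b : Fin n → Bool,
          (treeSize (fun z => f (Λ.piecewise z (U.piecewise b x))) : ℝ)) * (1 + p) ^ Λ.card := by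
          gcongr
      _ = _ := by field_simp
  have h5 := subsetExp_mono hq0 hq1 hfix
  have h6 : 1 / (32 * k : ℝ) * (1 + p) + (1 - 1 / (32 * k)) = 1 + 1 / (32 * k) * p := by ring
  rw [subsetExp_mul_left, subsetExp_pow, h6] at h5
  refine le_trans (le_of_eq ?_) (h5.trans hmain)
  rw [div_pow, mul_div_assoc', mul_div_right_comm]

end step

/-! ### Circuits of small depth -/

theorem GateOp.eval_map {W W' : Type} (e : W ↪ W') (v : W' → Bool) (I : Finset W) (op : GateOp) :
    op.eval v (I.map e) = op.eval (fun w => v (e w)) I := by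
  cases op <;> simp [GateOp.eval]

/-- Every gate is an AND or an OR of nodes of smaller depth. -/
theorem Gates.exists_inputs {α : Type} {m : ℕ} (G : Gates α m) (i : Fin m) :
    ∃ (op : GateOp) (I : Finset (α ⊕ Fin m)),
      (∀ a, G.val a i = op.eval (Sum.elim a (G.val a)) I) ∧
      ∀ w ∈ I, Sum.elim (fun _ => 0) G.depth w < G.depth i := by
  induction G with
  | nil => exact i.elim0
  | @snoc m G op I ih =>
    let e : (α ⊕ Fin m) ↪ (α ⊕ Fin (m + 1)) :=
      ⟨Sum.map id Fin.castSucc,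
        Sum.map_injective.2 ⟨Function.injective_id, Fin.castSucc_injective m⟩⟩
    have hval : ∀ a (w : α ⊕ Fin m),
        Sum.elim a ((G.snoc op I).val a) (e w) = Sum.elim a (G.val a) w := by
      rintro a (l | w)
      · rfl
      · simp [Gates.val, e]
    have hdepth : ∀ w : α ⊕ Fin m,
        Sum.elim (fun _ => 0) (G.snoc op I).depth (e w)
          = Sum.elim (fun _ => 0) G.depth w := by
      rintro (l | w)
      · rfl
      · simp [Gates.depth, e]
    induction i using Fin.lastCases with
    | last =>
      refine ⟨op, I.map e, fun a => ?_, fun w hw => ?_⟩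
      · simp only [GateOp.eval_map, hval]
        simp [Gates.val]
      · obtain ⟨w, hwI, rfl⟩ := mem_map.1 hw
        rw [hdepth]
        simp only [Gates.depth, Fin.snoc_last]
        exact Nat.lt_succ_of_le
          (le_sup (f := fun w => Sum.elim (fun _ => 0) G.depth w) hwI)
    | cast i =>
      obtain ⟨op', I', h1, h2⟩ := ih i
      refine ⟨op', I'.map e, fun a => ?_, fun w hw => ?_⟩
      · simp only [GateOp.eval_map, hval, ← h1]
        simp [Gates.val]
      · obtain ⟨w, hwI, rfl⟩ := mem_map.1 hw
        rw [hdepth]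
        simpa [Gates.depth] using h2 w hwI

section levels

variable {n : ℕ}

/-- On the subcube of the assignments that agree with `x` outside `Λ`, all gates of depth at most
`j` have decision trees of depth at most `r`. -/
def GatesShallow (c : Circuit (Literal n)) (r j : ℕ) (Λ : Finset (Fin n)) (x : Fin n → Bool) :
    Prop :=
  ∀ i, c.gates.depth i ≤ j →
    DepthLE r (fun z => c.gates.val (Literal.eval (Λ.piecewise z x)) i)

theorem Literal.eval_congr {x y : Fin n → Bool} {l : Literal n} (h : x l.1 = y l.1) :
    Literal.eval x l = Literal.eval y l := by
  simp [Literal.eval, h]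

theorem Literal.exists_certificate {k : ℕ} (hk : 1 ≤ k) (Λ : Finset (Fin n))
    (x y : Fin n → Bool) (l : Literal n) :
    ∃ D : Finset (Fin n), D.card ≤ k ∧ ∀ z, (∀ i ∈ D, z i = y i) →
      Literal.eval (Λ.piecewise z x) l = Literal.eval (Λ.piecewise y x) l := by
  refine ⟨{l.1}, by simpa using hk, fun z hz => Literal.eval_congr ?_⟩
  have := hz l.1 (mem_singleton_self _)
  by_cases hl : l.1 ∈ Λ <;> simp [hl, this]

/-- If the gates of depth at most `j` are shallow on a subcube, then a node of depth at most
`j + 1` is there a DNF of small width (an OR gate) or the negation of one (an AND gate). -/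
theorem GatesShallow.hasCertificates {c : Circuit (Literal n)} {k j : ℕ} (hk : 1 ≤ k)
    {Λ : Finset (Fin n)} {x : Fin n → Bool} (hs : GatesShallow c k j Λ x)
    (w : Literal n ⊕ Fin c.size) (hw : Sum.elim (fun _ => 0) c.gates.depth w ≤ j + 1) :
    HasCertificates k (fun z => Sum.elim (Literal.eval (Λ.piecewise z x))
        (c.gates.val (Literal.eval (Λ.piecewise z x))) w) ∨
      HasCertificates k (fun z => !Sum.elim (Literal.eval (Λ.piecewise z x))
        (c.gates.val (Literal.eval (Λ.piecewise z x))) w) := by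
  rcases w with l | i
  · left
    intro y hy
    obtain ⟨D, hD, hz⟩ := Literal.exists_certificate hk Λ x y l
    exact ⟨D, hD, fun z h => (hz z h).trans hy⟩
  · obtain ⟨op, I, hval, hlt⟩ := c.gates.exists_inputs i
    have hin : ∀ w ∈ I, ∀ y : Fin n → Bool, ∃ D : Finset (Fin n), D.card ≤ k ∧
        ∀ z : Fin n → Bool, (∀ i ∈ D, z i = y i) →
          Sum.elim (Literal.eval (Λ.piecewise z x))
              (c.gates.val (Literal.eval (Λ.piecewise z x))) w
            = Sum.elim (Literal.eval (Λ.piecewise y x))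
              (c.gates.val (Literal.eval (Λ.piecewise y x))) w := by
      intro w hwI y
      have hd := hlt w hwI
      rcases w with l | i'
      · exact Literal.exists_certificate hk Λ x y l
      · simp only [Sum.elim_inr] at hd hw
        exact (hs i' (by omega)).exists_certificate y
    simp only [Sum.elim_inr, hval]
    cases op with
    | or =>
      left
      intro y hy
      simp only [GateOp.eval, decide_eq_true_eq] at hy ⊢
      obtain ⟨w, hwI, hwy⟩ := hy
      obtain ⟨D, hD, hz⟩ := hin w hwI y
      exact ⟨D, hD, fun z h => ⟨w, hwI, (hz z h).trans hwy⟩⟩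
    | and =>
      right
      intro y hy
      simp only [GateOp.eval, Bool.not_eq_true', decide_eq_false_iff_not, not_forall] at hy ⊢
      obtain ⟨w, hwI, hwy⟩ := hy
      obtain ⟨D, hD, hz⟩ := hin w hwI y
      exact ⟨D, hD, fun z h => ⟨w, hwI, by rwa [hz z h]⟩⟩

theorem treeSize_le_one {h : (Fin n → Bool) → Bool} (hc : ∀ z z', h z = h z') : treeSize h ≤ 1 :=
  treeSize_le (.const hc)

/-- The last switching step concerns a single function, the output, so the threshold depth `0` is
affordable: it makes the output constant. -/
theorem treeSize_mul_pow_le_of_depth_le {c : Circuit (Literal n)} {k j : ℕ} (hk : 1 ≤ k)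
    {U : Finset (Fin n)} {x : Fin n → Bool} (hs : GatesShallow c k j U x)
    (hd : c.depth ≤ j + 1) :
    (treeSize (fun z => c.eval (Literal.eval (U.piecewise z x))) : ℝ) *
      ((1 + 1 / (32 * k)) / 2) ^ U.card ≤ 2 := by
  have h := treeSize_mul_pow_le (ℓ := 0) hk (ι := Unit) (by simp)
    (fun z => c.eval (Literal.eval z)) (fun _ z => c.eval (Literal.eval z)) U x
    (fun _ => hs.hasCertificates hk c.output hd) zero_le_one le_rfl zero_le_one
    (fun Λ y hsh => by
      have : treeSize (fun z => c.eval (Literal.eval (Λ.piecewise z y))) ≤ 1 :=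
        treeSize_le_one (hsh ())
      simpa using this)
  simpa using h

/-- A switching step makes one more level of gates shallow. -/
theorem treeSize_mul_pow_le_of_level {c : Circuit (Literal n)} {k ℓ j : ℕ} (hk : 1 ≤ k)
    (hsize : c.size ≤ 2 ^ ℓ)
    {U : Finset (Fin n)} {x : Fin n → Bool} (hs : GatesShallow c k j U x)
    {p A : ℝ} (hp0 : 0 ≤ p) (hp1 : p ≤ 1) (hA : 0 ≤ A)
    (hstep : ∀ Λ y, GatesShallow c ℓ (j + 1) Λ y →
      (treeSize (fun z => c.eval (Literal.eval (Λ.piecewise z y))) : ℝ) *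
        ((1 + p) / 2) ^ Λ.card ≤ A) :
    (treeSize (fun z => c.eval (Literal.eval (U.piecewise z x))) : ℝ) *
      ((1 + 1 / (32 * k) * p) / 2) ^ U.card ≤ 2 * A := by
  refine treeSize_mul_pow_le (ℓ := ℓ) hk (ι := {i // c.gates.depth i ≤ j + 1}) ?_
    (fun z => c.eval (Literal.eval z)) (fun i z => c.gates.val (Literal.eval z) i) U x
    (fun i => hs.hasCertificates hk (Sum.inr i.1) i.2) hp0 hp1 hA
    (fun Λ y hsh => hstep Λ y fun i hi => hsh ⟨i, hi⟩)
  exact (Fintype.card_subtype_le _).trans (by simpa using hsize)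

/-- The bound once the gates of depth at most `j` are shallow, with `e + 1` levels to go. -/
theorem treeSize_mul_pow_le_of_shallow {c : Circuit (Literal n)} {ℓ : ℕ} (hℓ : 1 ≤ ℓ)
    (hsize : c.size ≤ 2 ^ ℓ) (e j : ℕ) (hd : c.depth ≤ j + e + 1)
    (U : Finset (Fin n)) (x : Fin n → Bool) (hs : GatesShallow c ℓ j U x) :
    (treeSize (fun z => c.eval (Literal.eval (U.piecewise z x))) : ℝ) *
      ((1 + (1 / (32 * ℓ)) ^ (e + 1)) / 2) ^ U.card ≤ 2 ^ (e + 1) := by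
  induction e generalizing j U x with
  | zero => simpa using treeSize_mul_pow_le_of_depth_le hℓ hs hd
  | succ e ih =>
    have hℓ' : (1 : ℝ) ≤ ℓ := by exact_mod_cast hℓ
    rw [pow_succ' _ (e + 1), pow_succ' (2 : ℝ) (e + 1)]
    refine treeSize_mul_pow_le_of_level hℓ hsize hs (by positivity) ?_ (by positivity)
      (fun Λ y h => ih (j + 1) (by omega) Λ y h)
    refine pow_le_one₀ (by positivity) ?_
    rw [div_le_one (by positivity)]
    linarith

/-- A circuit of depth at most `e + 1` with at most `2 ^ ℓ` gates has a decision tree with at most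
`2 ^ (e + 1) * (2 / (1 + p)) ^ n` leaves, where `p = 1 / (32 * (32 * ℓ) ^ e)`. -/
theorem treeSize_circuit_mul_pow_le {c : Circuit (Literal n)} {ℓ : ℕ} (hℓ : 1 ≤ ℓ)
    (hsize : c.size ≤ 2 ^ ℓ) (e : ℕ) (hd : c.depth ≤ e + 1) :
    (treeSize (fun z => c.eval (Literal.eval z)) : ℝ) *
      ((1 + 1 / 32 * (1 / (32 * ℓ)) ^ e) / 2) ^ n ≤ 2 ^ (e + 1) := by
  have hs : GatesShallow c 1 0 univ (fun _ => false) := by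
    intro i hi
    exfalso
    -- Every gate has depth at least one.
    have hpos : ∀ {m : ℕ} (G : Gates (Literal n) m) (i : Fin m), 0 < G.depth i := by
      intro m G i
      induction G with
      | nil => exact i.elim0
      | snoc G op I ih =>
        induction i using Fin.lastCases with
        | last => simp [Gates.depth]
        | cast i => simpa [Gates.depth] using ih i
    have := hpos c.gates i
    omega
  cases e with
  | zero =>
    have h := treeSize_mul_pow_le_of_depth_le le_rfl hs hd
    simpa using h
  | succ e =>
    have hℓ' : (1 : ℝ) ≤ ℓ := by exact_mod_cast hℓ
    have h := treeSize_mul_pow_le_of_level (ℓ := ℓ) (p := (1 / (32 * ℓ)) ^ (e + 1)) le_rfl hsize hs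
      (by positivity)
      (pow_le_one₀ (by positivity) (by rw [div_le_one (by positivity)]; linarith))
      (by positivity)
      (fun Λ y h => treeSize_mul_pow_le_of_shallow hℓ hsize e 1 (by omega) Λ y h)
    rw [pow_succ' (2 : ℝ) (e + 1)]
    simpa using h

end levels

/-! ### Monotone functions with small decision trees -/

section monotone

variable {n : ℕ}

theorem update_le_update {x y : Fin n → Bool} (h : x ≤ y) (i : Fin n) {a b : Bool} (hab : a ≤ b) :
    Function.update x i a ≤ Function.update y i b :=
  update_le_update_iff.2 ⟨hab, fun j _ => h j⟩

theorem monotone_update {f : (Fin n → Bool) → Bool} (hf : Monotone f) (i : Fin n) (c : Bool) :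
    Monotone (fun z => f (Function.update z i c)) :=
  fun _ _ h => hf (update_le_update h i le_rfl)

/-- The Shannon expansion of a monotone function needs no negation. -/
theorem eq_or_and_of_monotone {f : (Fin n → Bool) → Bool} (hf : Monotone f) (i : Fin n)
    (x : Fin n → Bool) :
    f x = (f (Function.update x i false) || (x i && f (Function.update x i true))) := by
  have hle : f (Function.update x i false) ≤ f (Function.update x i true) :=
    hf (update_le_update le_rfl i (Bool.false_le _))
  have hx : f (Function.update x i (x i)) = f x := by rw [Function.update_eq_self]
  revert hle hx
  cases x i <;> simp only [Bool.false_and, Bool.true_and, Bool.or_false] <;>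
    generalize f (Function.update x i false) = a <;>
    generalize f (Function.update x i true) = b <;>
    generalize f x = c <;> revert a b c <;> decide

/-- The true leaves of a decision tree for a monotone function give the terms of a monotone DNF. -/
theorem HasTree.exists_monotone_dnf {f : (Fin n → Bool) → Bool} {N : ℕ} (hN : HasTree f N)
    (hf : Monotone f) : ∃ D : DNF n, D.IsMonotone ∧ D.card ≤ N ∧ ∀ x, D.eval x = f x := by
  induction hN with
  | @const f hc =>
    by_cases h : f (fun _ => false) = true
    · refine ⟨{∅}, by simp [DNF.IsMonotone], by simp, fun x => ?_⟩
      rw [hc x (fun _ => false), h]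
      simp [DNF.eval]
    · refine ⟨∅, by simp [DNF.IsMonotone], by simp, fun x => ?_⟩
      rw [hc x (fun _ => false), Bool.eq_false_iff.2 h]
      simp [DNF.eval]
  | @node f i N₀ N₁ _ _ ih₀ ih₁ =>
    obtain ⟨D₀, hm₀, hc₀, he₀⟩ := ih₀ (monotone_update hf i false)
    obtain ⟨D₁, hm₁, hc₁, he₁⟩ := ih₁ (monotone_update hf i true)
    beta_reduce at he₀ he₁
    refine ⟨D₀ ∪ D₁.image (insert (i, true)), ?_, ?_, fun x => ?_⟩
    · intro T hT l hl
      rcases mem_union.1 hT with hT | hT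
      · exact hm₀ T hT l hl
      · obtain ⟨T', hT', rfl⟩ := mem_image.1 hT
        rcases mem_insert.1 hl with rfl | hl
        · rfl
        · exact hm₁ T' hT' l hl
    · exact (card_union_le _ _).trans (add_le_add hc₀ (card_image_le.trans hc₁))
    · rw [eq_or_and_of_monotone hf i x, ← he₀, ← he₁, Bool.eq_iff_iff]
      simp only [DNF.eval, decide_eq_true_eq, Bool.or_eq_true, Bool.and_eq_true, mem_union,
        mem_image]
      constructor
      · rintro ⟨T, hT | ⟨T', hT', rfl⟩, h⟩
        · exact Or.inl ⟨T, hT, h⟩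
        · refine Or.inr ⟨?_, T', hT', fun l hl => h l (mem_insert_of_mem hl)⟩
          simpa [Literal.eval] using h (i, true) (mem_insert_self _ _)
      · rintro (⟨T, hT, h⟩ | ⟨hx, T, hT, h⟩)
        · exact ⟨T, Or.inl hT, h⟩
        · refine ⟨_, Or.inr ⟨T, hT, rfl⟩, fun l hl => ?_⟩
          rcases mem_insert.1 hl with rfl | hl
          · simpa [Literal.eval] using hx
          · exact h l hl

/-- Any list of monotone gates can be extended, by two gates for each inner node of a decision
tree for the monotone function `f`, so that some node computes `f`. -/
theorem HasTree.exists_monotone_gates {f : (Fin n → Bool) → Bool} {N : ℕ} (hN : HasTree f N)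
    (hf : Monotone f) {m : ℕ} (G : Gates (MonoInput n) m) (hG : G.FanInLE 2) :
    ∃ (m' : ℕ) (G' : Gates (MonoInput n) m') (e : Fin m → Fin m')
      (o : MonoInput n ⊕ Fin m'), G'.FanInLE 2 ∧ m' + 2 ≤ m + 2 * N ∧
      (∀ a i, G'.val a (e i) = G.val a i) ∧
      ∀ x, Sum.elim (Sum.elim x id) (G'.val (Sum.elim x id)) o = f x := by
  induction hN generalizing m with
  | @const f hc =>
    exact ⟨m, G, id, Sum.inl (Sum.inr (f fun _ => false)), hG, le_rfl, fun _ _ => rfl,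
      fun x => hc _ _⟩
  | @node f i N₀ N₁ _ _ ih₀ ih₁ =>
    obtain ⟨m₀, G₀, e₀, o₀, hG₀, hm₀, hv₀, ho₀⟩ := ih₀ (monotone_update hf i false) G hG
    obtain ⟨m₁, G₁, e₁, o₁, hG₁, hm₁, hv₁, ho₁⟩ := ih₁ (monotone_update hf i true) G₀ hG₀
    beta_reduce at ho₀ ho₁
    let I : Finset (MonoInput n ⊕ Fin m₁) := {Sum.inl (Sum.inl i), o₁}
    let J : Finset (MonoInput n ⊕ Fin (m₁ + 1)) :=
      {Sum.map id (Fin.castSucc ∘ e₁) o₀, Sum.inr (Fin.last m₁)}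
    refine ⟨m₁ + 2, (G₁.snoc .and I).snoc .or J, fun i => (e₁ (e₀ i)).castSucc.castSucc,
      Sum.inr (Fin.last (m₁ + 1)), ⟨⟨hG₁, card_le_two⟩, card_le_two⟩, by omega, fun a i => ?_,
      fun x => ?_⟩
    · simp [Gates.val, hv₀, hv₁]
    · have h₀ : Sum.elim (Sum.elim x id) ((G₁.snoc .and I).val (Sum.elim x id))
          (Sum.map id (Fin.castSucc ∘ e₁) o₀) = f (Function.update x i false) := by
        rw [← ho₀ x]
        rcases o₀ with l | w
        · rfl
        · simp [Gates.val, hv₁]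
      rw [eq_or_and_of_monotone hf i x, ← ho₁ x, ← h₀, Bool.eq_iff_iff]
      simp [Gates.val, GateOp.eval, I, J]

theorem HasTree.mem_mSIZE {f : (Fin n → Bool) → Bool} {N : ℕ} (hN : HasTree f N)
    (hf : Monotone f) {t : ℝ} (ht : 2 * ((N : ℝ) - 1) ≤ t) : f ∈ mSIZE n t := by
  obtain ⟨m', G', -, o, hG', hm', -, ho⟩ := hN.exists_monotone_gates hf .nil trivial
  refine ⟨⟨m', G', o⟩, hG', ?_, ho⟩
  have : (m' : ℝ) + 2 ≤ 2 * N := by exact_mod_cast (by omega : m' + 2 ≤ 2 * N)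
  show (m' : ℝ) ≤ t
  linarith

/-- Two variables of a monotone function are resolved by a decision tree with three leaves. -/
theorem treeSize_le_three {f : (Fin n → Bool) → Bool} (hf : Monotone f) {i j : Fin n}
    (hij : i ≠ j) (hdep : ∀ z z', z i = z' i → z j = z' j → f z = f z') : treeSize f ≤ 3 := by
  have hconst : ∀ b c : Bool,
      HasTree (fun z => f (Function.update (Function.update z j c) i b)) 1 := by
    intro b c
    refine .const fun z z' => hdep _ _ (by simp) ?_
    simp [hij.symm]
  have hconst' : ∀ b c : Bool,
      HasTree (fun z => f (Function.update (Function.update z i b) j c)) 1 := by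
    intro b c
    simpa only [Function.update_comm hij] using hconst b c
  let v : Bool → Bool → Bool := fun b c =>
    f (Function.update (Function.update (fun _ => false) j c) i b)
  have hv : ∀ z, f z = v (z i) (z j) := fun z => hdep _ _ (by simp) (by simp [hij.symm])
  by_cases h0 : v false false = v false true
  · refine treeSize_le (.node i (N₀ := 1) (N₁ := 2) (.const fun z z' => ?_)
      (.node j (N₀ := 1) (N₁ := 1) (hconst true false) (hconst true true)))
    have : ∀ z, f (Function.update z i false) = v false true := by
      intro z
      rw [hv]
      cases hz : z j <;> simp [hij.symm, hz, h0]
    rw [this, this]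
  · by_cases h1 : v true false = v true true
    · refine treeSize_le (.node i (N₀ := 2) (N₁ := 1)
        (.node j (N₀ := 1) (N₁ := 1) (hconst false false) (hconst false true))
        (.const fun z z' => ?_))
      have : ∀ z, f (Function.update z i true) = v true true := by
        intro z
        rw [hv]
        cases hz : z j <;> simp [hij.symm, hz, h1]
      rw [this, this]
    · -- Now `f` is the projection to the variable `j`.
      have hmono : ∀ b, v b false ≤ v b true := fun b =>
        hf (update_le_update (update_le_update le_rfl j (Bool.false_le _)) i le_rfl)
      have hm0 := hmono false
      have hm1 := hmono true
      have key : v false false = v true false ∧ v false true = v true true := by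
        revert h0 h1 hm0 hm1
        generalize v false false = a
        generalize v false true = b
        generalize v true false = c
        generalize v true true = d
        revert a b c d
        decide
      have : ∀ c z, f (Function.update z j c) = v false c := by
        intro c z
        rw [hv]
        cases c <;> cases hz : z i <;> simp [hij, hz, key]
      refine (treeSize_le (.node j (N₀ := 1) (N₁ := 1) (.const fun z z' => ?_)
        (.const fun z z' => ?_))).trans (by norm_num)
      · rw [this, this]
      · rw [this, this]

/-- A monotone function never needs the full tree: all variables but two are queried blindly, and a
monotone function of two variables needs three leaves only. -/
theorem treeSize_le_of_monotone (hn : 2 ≤ n) {f : (Fin n → Bool) → Bool} (hf : Monotone f) :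
    (treeSize f : ℝ) ≤ 3 / 4 * 2 ^ n := by
  let i : Fin n := ⟨0, by omega⟩
  let j : Fin n := ⟨1, by omega⟩
  have hij : i ≠ j := by simp [i, j, Fin.ext_iff]
  let S : Finset (Fin n) := univ \ {i, j}
  have hS : univ \ S = {i, j} := by simp [S]
  have hcard : S.card + 2 = n := by
    have h1 : ({i, j} : Finset (Fin n)).card = 2 := card_pair hij
    have h2 := card_sdiff_of_subset (subset_univ ({i, j} : Finset (Fin n)))
    rw [h1, card_univ, Fintype.card_fin] at h2
    have h3 : S.card = n - 2 := h2
    omega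
  have h1 := le_two_pow_mul_expect_of_split (U := univ)
    (ω := fun Λ y => (treeSize (fun z => f (Λ.piecewise z y)) : ℝ))
    (fun Λ _ y i hi => by exact_mod_cast treeSize_restrict_le_sum f Λ y hi)
    (Λ := univ) le_rfl S (subset_univ S) (fun _ => false)
  simp only [piecewise_univ] at h1
  have h2 : 𝔼 b : Fin n → Bool, (treeSize (fun z => f ((univ \ S).piecewise z
      (S.piecewise b fun _ => false))) : ℝ) ≤ 3 := by
    refine expect_le univ_nonempty fun b _ => ?_
    have : treeSize (fun z => f ((univ \ S).piecewise z
        (S.piecewise b fun _ => false))) ≤ 3 := by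
      refine treeSize_le_three (fun z z' h => hf ?_) hij fun z z' hi hj => ?_
      · exact Finset.piecewise_le_piecewise _ h le_rfl
      · congr 1
        ext l
        by_cases hl : l ∈ univ \ S
        · have hl' := hl
          rw [hS, mem_insert, mem_singleton] at hl'
          rw [piecewise_eq_of_mem _ _ _ hl, piecewise_eq_of_mem _ _ _ hl]
          rcases hl' with rfl | rfl
          · exact hi
          · exact hj
        · rw [piecewise_eq_of_notMem _ _ _ hl, piecewise_eq_of_notMem _ _ _ hl]
    exact_mod_cast this
  have h3 : (2 : ℝ) ^ n = 2 ^ S.card * 4 := by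
    conv_lhs => rw [← hcard]
    rw [pow_add]
    norm_num
  calc (treeSize f : ℝ) ≤ _ := h1
    _ ≤ 2 ^ S.card * 3 := by gcongr
    _ = 3 / 4 * 2 ^ n := by
      rw [h3]
      ring

end monotone

/-! ### The bound -/

theorem clog_le_two_mul_logb {s : ℕ} (hs : 2 ≤ s) :
    (Nat.clog 2 s : ℝ) ≤ 2 * Real.logb 2 s := by
  have hs' : (2 : ℝ) ≤ s := by exact_mod_cast hs
  have h1 : 1 ≤ Real.logb 2 s := by
    rw [Real.le_logb_iff_rpow_le (by norm_num) (by linarith)]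
    simpa using hs'
  have h2 : ((Nat.clog 2 s - 1 : ℕ) : ℝ) ≤ Real.logb 2 s := by
    rw [Real.le_logb_iff_rpow_le (by norm_num) (by linarith), Real.rpow_natCast]
    exact_mod_cast (Nat.pow_pred_clog_lt_self (by norm_num) hs).le
  have h3 : Nat.clog 2 s ≤ (Nat.clog 2 s - 1) + 1 := by omega
  have h4 : (Nat.clog 2 s : ℝ) ≤ ((Nat.clog 2 s - 1 : ℕ) : ℝ) + 1 := by exact_mod_cast h3
  linarith

/-- The decision-tree size of a monotone function computed by a circuit of depth at most `e + 1`. -/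
theorem treeSize_le_simBound {n e s : ℕ} (hs : 2 ≤ s) (hn : 2 ≤ n)
    {f : (Fin n → Bool) → Bool} (hf : Monotone f) (hc : f ∈ AC0 n (e + 1) s) :
    (treeSize f : ℝ) ≤ simBound 192 n (e + 1) s := by
  obtain ⟨c, hd, hsize, hcf⟩ := hc
  have hs' : (2 : ℝ) ≤ s := by exact_mod_cast hs
  set L := Real.logb 2 s with hL
  have hL1 : 1 ≤ L := by
    rw [hL, Real.le_logb_iff_rpow_le (by norm_num) (by linarith)]
    simpa using hs'
  have hℓ : 1 ≤ Nat.clog 2 s := Nat.clog_pos (by norm_num) hs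
  have hℓ' : (1 : ℝ) ≤ Nat.clog 2 s := by exact_mod_cast hℓ
  have hℓL : (Nat.clog 2 s : ℝ) ≤ 2 * L := clog_le_two_mul_logb hs
  have hfc : (fun z => c.eval (Literal.eval z)) = f := funext hcf
  have htree := treeSize_circuit_mul_pow_le hℓ
    (hsize.trans (Nat.le_pow_clog (by norm_num) s)) e hd
  rw [hfc] at htree
  set P : ℝ := 32 * (64 * L) ^ e with hP
  have hP1 : 1 ≤ P := by
    have : 1 ≤ (64 * L) ^ e := one_le_pow₀ (by linarith)
    linarith
  have hE : (192 * (192 * L) ^ e : ℝ) = 6 * 3 ^ e * P := by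
    rw [hP, show (192 * L : ℝ) = 3 * (64 * L) by ring, mul_pow 3 (64 * L)]
    ring
  have hp : 1 / P ≤ 1 / 32 * (1 / (32 * Nat.clog 2 s : ℝ)) ^ e := by
    rw [hP, one_div_pow, one_div_mul_one_div]
    apply one_div_le_one_div_of_le (by positivity)
    have : (32 * Nat.clog 2 s : ℝ) ^ e ≤ (64 * L) ^ e :=
      pow_le_pow_left₀ (by positivity) (by linarith) e
    linarith
  have h3e : (e : ℝ) + 1 ≤ 3 ^ e := by
    have h := one_add_mul_le_pow (a := (2 : ℝ)) (by norm_num) e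
    have h0 : (0 : ℝ) ≤ e := Nat.cast_nonneg e
    norm_num at h
    linarith
  rw [simBound, Nat.add_sub_cancel, ← hL, hE]
  rcases le_or_gt (2 * ((e : ℝ) + 1)) (n / P) with hbig | hsmall
  · -- Many variables: the factor `2 ^ (e + 1)` costs at most half of the savings `n / P`.
    have h2p : (2 : ℝ) ^ (1 / P) ≤ 1 + 1 / P := by
      have h := rpow_one_add_le_one_add_mul_self (s := 1) (by norm_num)
        (p := 1 / P) (by positivity) (by rw [div_le_one (by positivity)]; exact hP1)
      norm_num at h ⊢
      exact h
    have h1 : (treeSize f : ℝ) * (2 ^ (1 / P - 1)) ^ n ≤ 2 ^ (e + 1) := by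
      refine le_trans ?_ htree
      gcongr
      rw [Real.rpow_sub_one (by norm_num)]
      have := h2p.trans (add_le_add_right hp 1)
      gcongr
    rw [← Real.rpow_natCast, ← Real.rpow_mul (by norm_num), ← Real.rpow_natCast 2 (e + 1)] at h1
    have h2 : (treeSize f : ℝ) ≤ 2 ^ (((e + 1 : ℕ) : ℝ) - (1 / P - 1) * n) := by
      rw [Real.rpow_sub (by norm_num), le_div_iff₀ (by positivity)]
      exact h1
    refine h2.trans (Real.rpow_le_rpow_of_exponent_le (by norm_num) ?_)
    push_cast
    have h3 : (n : ℝ) * (1 / (6 * 3 ^ e * P)) ≤ n / P / 2 := by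
      rw [mul_one_div, div_div]
      have : (1 : ℝ) ≤ 3 ^ e := one_le_pow₀ (by norm_num)
      exact div_le_div_of_nonneg_left (Nat.cast_nonneg n) (by positivity) (by nlinarith)
    have h4 : (1 / P - 1) * n = n / P - n := by ring
    rw [h4, mul_sub, mul_one]
    linarith
  · -- Few variables: the savings required are less than the constant factor `3 / 4`.
    refine (treeSize_le_of_monotone hn hf).trans ?_
    have h34 : (3 / 4 : ℝ) ≤ 2 ^ (-(1 / 3) : ℝ) := by
      have h1 : ((2 : ℝ) ^ (-(1 / 3) : ℝ)) ^ 3 = 1 / 2 := by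
        rw [← Real.rpow_natCast, ← Real.rpow_mul (by norm_num)]
        norm_num
      by_contra hlt
      push Not at hlt
      have h2 := pow_lt_pow_left₀ hlt (by positivity) (n := 3) (by norm_num)
      rw [h1] at h2
      norm_num at h2
    calc (3 / 4 : ℝ) * 2 ^ n ≤ 2 ^ (-(1 / 3) : ℝ) * 2 ^ (n : ℝ) := by
          rw [Real.rpow_natCast]
          gcongr
      _ = 2 ^ ((n : ℝ) - 1 / 3) := by
          rw [← Real.rpow_add (by norm_num)]
          congr 1
          ring
      _ ≤ _ := by
          refine Real.rpow_le_rpow_of_exponent_le (by norm_num) ?_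
          have h3 : (n : ℝ) * (1 / (6 * 3 ^ e * P)) ≤ 1 / 3 := by
            rw [mul_one_div, div_le_iff₀ (by positivity)]
            rw [div_lt_iff₀ (by positivity)] at hsmall
            nlinarith
          rw [mul_sub, mul_one]
          linarith

theorem const_or_eq_apply_of_monotone {n : ℕ} (hn : n ≤ 1) {f : (Fin n → Bool) → Bool}
    (hf : Monotone f) : (∀ z z', f z = f z') ∨ ∃ i, ∀ x, f x = x i := by
  have hsub : Subsingleton (Fin n) := Fin.subsingleton_iff_le_one.2 hn
  by_cases hc : ∀ z z', f z = f z'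
  · exact Or.inl hc
  right
  push Not at hc
  obtain ⟨z, z', hzz⟩ := hc
  obtain ⟨i, -⟩ := Function.ne_iff.1 (fun h : z = z' => hzz (congrArg f h))
  have hall : ∀ x : Fin n → Bool, x = fun _ => x i := fun x => by
    ext j
    rw [Subsingleton.elim j i]
  have hle : f (fun _ => false) ≤ f (fun _ => true) := hf fun _ => Bool.false_le _
  refine ⟨i, fun x => ?_⟩
  rw [hall z, hall z'] at hzz
  rw [hall x]
  revert hle hzz
  cases z i <;> cases z' i <;> cases x i <;>
    generalize f (fun _ => false) = a <;> generalize f (fun _ => true) = b <;>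
    beta_reduce <;> revert a b <;> decide

theorem one_le_simBound {n d s : ℕ} (hs : 2 ≤ s) : 1 ≤ simBound 192 n d s := by
  have hs' : (2 : ℝ) ≤ s := by exact_mod_cast hs
  have hL1 : 1 ≤ Real.logb 2 s := by
    rw [Real.le_logb_iff_rpow_le (by norm_num) (by linarith)]
    simpa using hs'
  have h1 : 1 ≤ (192 * Real.logb 2 s) ^ (d - 1) := one_le_pow₀ (by linarith)
  refine Real.one_le_rpow (by norm_num) (mul_nonneg (Nat.cast_nonneg n) ?_)
  rw [sub_nonneg, div_le_one (by positivity)]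
  linarith

theorem mem_mSIZE_and_mDNF_of_treeSize {n : ℕ} {f : (Fin n → Bool) → Bool} (hf : Monotone f)
    {B : ℝ} (hB : (treeSize f : ℝ) ≤ B) (hn : 2 * ((treeSize f : ℝ) - 1) ≤ n * B) :
    f ∈ mSIZE n (n * B) ∧ f ∈ mDNF n B := by
  refine ⟨(hasTree_treeSize f).mem_mSIZE hf hn, ?_⟩
  obtain ⟨D, hm, hcard, he⟩ := (hasTree_treeSize f).exists_monotone_dnf hf
  exact ⟨D, hm, le_trans (by exact_mod_cast hcard) hB, he⟩

end MonoSim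

open MonoSim in
theorem mainTheorem6 :
    ∃ C : ℝ, 0 < C ∧
      ∀ d n s : ℕ, 1 ≤ d → 2 ≤ s →
        ∀ f : (Fin n → Bool) → Bool, Monotone f → f ∈ MonoSim.AC0 n d s →
          f ∈ MonoSim.mSIZE n ((n : ℝ) * MonoSim.simBound C n d s) ∧
          f ∈ MonoSim.mDNF n (MonoSim.simBound C n d s) := by
  refine ⟨192, by norm_num, fun d n s hd hs f hf hc => ?_⟩
  have hB := one_le_simBound (n := n) (d := d) hs
  rcases le_or_gt 2 n with hn | hn
  · obtain ⟨e, rfl⟩ := Nat.exists_eq_add_of_le' hd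
    have h1 := treeSize_le_simBound hs hn hf hc
    have hn' : (2 : ℝ) ≤ n := by exact_mod_cast hn
    exact mem_mSIZE_and_mDNF_of_treeSize hf h1 (by nlinarith)
  · -- The tree of a single variable has two leaves, too many for the bound: it is an input.
    rcases const_or_eq_apply_of_monotone (by omega) hf with hconst | ⟨i, hi⟩
    · have h1 : (treeSize f : ℝ) ≤ 1 := by exact_mod_cast treeSize_le_one hconst
      have : 0 ≤ (n : ℝ) * simBound 192 n d s := by positivity
      exact mem_mSIZE_and_mDNF_of_treeSize hf (h1.trans hB) (by linarith)
    · refine ⟨⟨⟨0, .nil, Sum.inl (Sum.inl i)⟩, trivial, ?_, fun x => (hi x).symm⟩,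
        {{(i, true)}}, by simp [DNF.IsMonotone], by simpa using hB, fun x => ?_⟩
      · simp only [Nat.cast_zero]
        positivity
      · rw [hi]
        simp [DNF.eval, Literal.eval]
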